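/- Setting. Fix $0<v_{\min}<v_{\max}$, densities $n_\pm>0$ and even probability densities $f_\pm$ on $\mathbb R$ that vanish unless $v_{\min}<|v|<v_{\max}$, and put $p_\pm=n_\pm f_\pm$. At time $0$ the positions and velocities of the atoms (point particles of mass $m$) form a Poisson process on the $(x,v)$-plane with density $p_-(v)$ for $x<0$ and $p_+(v)$ for $x>0$. A piston (a point particle of mass $M$) starts at the origin with velocity $u$. Atoms do not interact with each other. When an atom of velocity $v$ meets the piston of velocity $V$, the atom gets the velocity $$v'=-\frac{M-m}{M+m}\,v+\frac{2M}{M+m}\,V,$$ and the piston gets the velocity $V'=\frac{M-m}{M+m}V+\frac{2m}{M+m}v$, replaced by $2\bar V-V'$ if $V'>\bar V$ and by $-2\bar V-V'$ if $V'<-\bar V$. Between collisions all velocities are constant. Here $\bar V>0$ is a fixed cutoff with $\bar V<\frac{M-m}{3M+m}\,v_{\min}$. Let $W(t)$ be the velocity of the piston, let $\mu_0$ be a stationary probability measure on $[-\bar V,\bar V]$ for the transition probabilities of $W$, and let $\langle\cdot\rangle$ denote the average with respect to $\mu_0$. Let $\mathcal E_-$ and $\mathcal M_-$ be the kinetic energy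 and the momentum of the gas on the left of the piston. Their rates of change $d\mathcal E_- /dt$ and $d\mathcal M_- /dt$ at $u$ are the derivatives at $\Delta t=0^+$ of the conditional mean changes of $\mathcal E_-$ and $\mathcal M_-$ during a time $\Delta t$, given that the piston starts with velocity $u$. The heat flow from right to left is $$R_{+\to-}=\langle d\mathcal E_- /dt\rangle-\langle d\mathcal M_- /dt\rangle\,\langle W\rangle .$$ Put $F_k^-=\int_{v_{\min}}^{v_{\max}}v^kp_-(v)\,dv$, $F_k^+=\int_{-v_{\max}}^{-v_{\min}}v^kp_+(v)\,dv$, $Q_k=F_k^--F_k^+$ and $\varepsilon=m/M$. Claim. Assume that the pressures are equal, i.e. $Q_2=0$. Then there are constants $C$ and $\varepsilon_0>0$, depending only on $p_\pm$, $v_{\min}$, $v_{\max}$ and $\bar V$, such that, whenever $\varepsilon<\varepsilon_0$ (and $\bar V<\frac{M-m}{3M+m}v_{\min}$), the means and rates above exist and $$\left|R_{+\to-}-\frac{2m\varepsilon}{Q_1}\left(F_1^+F_3^--F_1^-F_3^+\right)\right|\le C\,m\,\varepsilon^2 .$$ In particular, for fixed $m$, $R_{+\to-}=\frac{2m\varepsilon}{Q_1}(F_1^+F_3^--F_1^-F_3^+)+O(\varepsilon^2)$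 as $\varepsilon\to0$. -/

import Mathlib

open MeasureTheory ProbabilityTheory Filter Topology Set

noncomputable section

namespace Piston

/-! ### The gas -/

/-- `f` is an even probability density on the line that vanishes unless `vmin < |v| < vmax`. -/
structure IsVelocityDensity (vmin vmax : ℝ) (f : ℝ → ℝ) : Prop where
  measurable : Measurable f
  nonneg : ∀ v, 0 ≤ f v
  even : ∀ v, f (-v) = f v
  integrable : Integrable f
  integral_eq_one : ∫ v, f v = 1
  cutoff : ∀ v, |v| ≤ vmin ∨ vmax ≤ |v| → f v = 0

/-- The measure `p(x, v) dx dv` on the phase plane of one atom, where `p(x, v)` is `pL v` to the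
left of the origin and `pR v` to the right of it. -/
def gasIntensity (pL pR : ℝ → ℝ) : Measure (ℝ × ℝ) :=
  (volume : Measure (ℝ × ℝ)).withDensity
    fun z => ENNReal.ofReal (if z.1 < 0 then pL z.2 else pR z.2)

/-- The random set `Γ` is a Poisson process with intensity measure `ν`: it is a countable set, the
number of its points in a measurable set of finite `ν`-measure has the Poisson law with
parameter `ν D`, and the numbers of points in pairwise disjoint sets are independent. -/
structure IsPoissonProcess {Ω S : Type*} [MeasurableSpace Ω] [MeasurableSpace S]
    (Γ : Ω → Set S) (ν : Measure S) (P : Measure Ω) : Prop where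
  countable : ∀ ω, (Γ ω).Countable
  measurable_count : ∀ D : Set S, MeasurableSet D → Measurable fun ω => (Γ ω ∩ D).encard
  law_count : ∀ D : Set S, MeasurableSet D → ν D ≠ ⊤ →
    ∀ k : ℕ, P {ω | (Γ ω ∩ D).encard = k} = poissonMeasure (ν D).toNNReal {k}
  indep_count : ∀ (n : ℕ) (D : Fin n → Set S), (∀ i, MeasurableSet (D i)) →
    Pairwise (fun i j => Disjoint (D i) (D j)) →
    iIndepFun (fun i ω => (Γ ω ∩ D i).encard) P

/-- `F_k^- = ∫_{vmin}^{vmax} v^k p_-(v) dv`. -/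
def momentL (vmin vmax : ℝ) (pL : ℝ → ℝ) (k : ℕ) : ℝ :=
  ∫ v in vmin..vmax, v ^ k * pL v

/-- `F_k^+ = ∫_{-vmax}^{-vmin} v^k p_+(v) dv`. -/
def momentR (vmin vmax : ℝ) (pR : ℝ → ℝ) (k : ℕ) : ℝ :=
  ∫ v in (-vmax)..(-vmin), v ^ k * pR v

/-! ### The dynamics -/

/-- Velocity of the piston (mass `M`) after an elastic collision with an atom (mass `m`), the
velocities before the collision being `V` and `v`. -/
def pistonAfter (m M V v : ℝ) : ℝ := (M - m) / (M + m) * V + 2 * m / (M + m) * v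

/-- Velocity of the atom after that collision. -/
def atomAfter (m M V v : ℝ) : ℝ := -((M - m) / (M + m)) * v + 2 * M / (M + m) * V

/-- The reflection of the velocity of the piston at `±Vbar`. -/
def reflectVel (Vbar w : ℝ) : ℝ :=
  if Vbar < w then 2 * Vbar - w else if w < -Vbar then -2 * Vbar - w else w

/-- The upper bound `V_max` on the cutoff velocity of the piston. -/
def vMax (m M vmin : ℝ) : ℝ := (M - m) / (3 * M + m) * vmin

/-- The piston, with velocity `W s` at time `s` and initial position `0`, and the atom with initial
position and velocity `z = (x, v)` and velocity `c z s` at time `s` have the same position at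
time `t`. -/
def Meets (W : ℝ → ℝ) (c : ℝ × ℝ → ℝ → ℝ) (z : ℝ × ℝ) (t : ℝ) : Prop :=
  z.1 + ∫ s in (0 : ℝ)..t, c z s = ∫ s in (0 : ℝ)..t, W s

/-- The motion, at times `t ≥ 0`, of the piston and the atoms: `Γ` is the set of the initial
positions and velocities of the atoms, `u` the initial velocity of the piston, `W t` the velocity
of the piston and `c z t` the velocity of the atom that starts from `z ∈ Γ`. All velocities are
piecewise constant and right-continuous. They change only at collisions, by the elastic rule,
after which the velocity of the piston is reflected at `±Vbar`. Atoms do not interact with each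
other. -/
structure IsMotion (m M Vbar : ℝ) (Γ : Set (ℝ × ℝ)) (u : ℝ) (W : ℝ → ℝ)
    (c : ℝ × ℝ → ℝ → ℝ) : Prop where
  piston_init : W 0 = u
  atom_init : ∀ z ∈ Γ, c z 0 = z.2
  piston_right : ∀ t, 0 ≤ t → ∀ᶠ s in 𝓝[>] t, W s = W t
  atom_right : ∀ z ∈ Γ, ∀ t, 0 ≤ t → ∀ᶠ s in 𝓝[>] t, c z s = c z t
  piston_free : ∀ t, 0 < t → (∀ z ∈ Γ, ¬ Meets W c z t) → ∀ᶠ s in 𝓝[<] t, W s = W t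
  atom_free : ∀ z ∈ Γ, ∀ t, 0 < t → ¬ Meets W c z t → ∀ᶠ s in 𝓝[<] t, c z s = c z t
  collision : ∀ z ∈ Γ, ∀ t, 0 < t → Meets W c z t →
    ∃ V v : ℝ, (∀ᶠ s in 𝓝[<] t, W s = V ∧ c z s = v) ∧
      W t = reflectVel Vbar (pistonAfter m M V v) ∧ c z t = atomAfter m M V v

/-- The change, during `[0, t]`, of the kinetic energy of the gas on the left of the piston. -/
def leftEnergyGain (m : ℝ) (Γ : Set (ℝ × ℝ)) (c : ℝ × ℝ → ℝ → ℝ) (t : ℝ) : ℝ :=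
  ∑' z : {z : ℝ × ℝ // z ∈ Γ ∧ z.1 < 0}, (m / 2 * c z.1 t ^ 2 - m / 2 * z.1.2 ^ 2)

/-- The change, during `[0, t]`, of the momentum of the gas on the left of the piston. -/
def leftMomentumGain (m : ℝ) (Γ : Set (ℝ × ℝ)) (c : ℝ × ℝ → ℝ → ℝ) (t : ℝ) : ℝ :=
  ∑' z : {z : ℝ × ℝ // z ∈ Γ ∧ z.1 < 0}, (m * c z.1 t - m * z.1.2)

/-! ### The velocity process, its stationary measures and the heat flow -/

/-- For each initial velocity `u ∈ [-Vbar, Vbar]` of the piston, `W u ω t` and `c u ω z t` are the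
velocities of the piston and of the atoms in the random gas `Γ ω`. -/
structure IsPistonProcess {Ω : Type*} [MeasurableSpace Ω] (P : Measure Ω) (m M Vbar : ℝ)
    (Γ : Ω → Set (ℝ × ℝ)) (W : ℝ → Ω → ℝ → ℝ) (c : ℝ → Ω → ℝ × ℝ → ℝ → ℝ) : Prop where
  motion : ∀ u ∈ Icc (-Vbar) Vbar, ∀ᵐ ω ∂P, IsMotion m M Vbar (Γ ω) u (W u ω) (c u ω)
  measurable_velocity : ∀ t, 0 ≤ t → Measurable fun q : ℝ × Ω => W q.1 q.2 t
  measurable_energy : ∀ u ∈ Icc (-Vbar) Vbar, ∀ t, 0 ≤ t →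
    AEStronglyMeasurable (fun ω => leftEnergyGain m (Γ ω) (c u ω) t) P
  measurable_momentum : ∀ u ∈ Icc (-Vbar) Vbar, ∀ t, 0 ≤ t →
    AEStronglyMeasurable (fun ω => leftMomentumGain m (Γ ω) (c u ω) t) P

/-- The transition probability: the law of the velocity of the piston at time `t` when its velocity
at time `0` is `u`. -/
def transition {Ω : Type*} [MeasurableSpace Ω] (P : Measure Ω) (W : ℝ → Ω → ℝ → ℝ)
    (u t : ℝ) : Measure ℝ :=
  P.map fun ω => W u ω t

/-- `μ` is a stationary probability measure, on the interval `[-Vbar, Vbar]`, of the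
process of the velocity of the piston. -/
structure IsStationary {Ω : Type*} [MeasurableSpace Ω] (P : Measure Ω) (Vbar : ℝ)
    (W : ℝ → Ω → ℝ → ℝ) (μ : Measure ℝ) : Prop where
  prob : IsProbabilityMeasure μ
  supp : μ (Icc (-Vbar) Vbar)ᶜ = 0
  invariant : ∀ t, 0 ≤ t → ∀ A : Set ℝ, MeasurableSet A →
    ∫⁻ u, transition P W u t A ∂μ = μ A

/-- The conditional mean change of the kinetic energy of the left gas during `[0, t]`, given that
the piston has velocity `u` at time `0`. -/
def meanEnergyGain {Ω : Type*} [MeasurableSpace Ω] (P : Measure Ω) (m : ℝ)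
    (Γ : Ω → Set (ℝ × ℝ)) (c : ℝ → Ω → ℝ × ℝ → ℝ → ℝ) (u t : ℝ) : ℝ :=
  ∫ ω, leftEnergyGain m (Γ ω) (c u ω) t ∂P

/-- The conditional mean change of the momentum of the left gas during `[0, t]`, given that
the piston has velocity `u` at time `0`. -/
def meanMomentumGain {Ω : Type*} [MeasurableSpace Ω] (P : Measure Ω) (m : ℝ)
    (Γ : Ω → Set (ℝ × ℝ)) (c : ℝ → Ω → ℝ × ℝ → ℝ → ℝ) (u t : ℝ) : ℝ :=
  ∫ ω, leftMomentumGain m (Γ ω) (c u ω) t ∂P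

/-- The rate of change of the kinetic energy of the left gas, given that the
piston has velocity `u`. -/
def energyRate {Ω : Type*} [MeasurableSpace Ω] (P : Measure Ω) (m : ℝ)
    (Γ : Ω → Set (ℝ × ℝ)) (c : ℝ → Ω → ℝ × ℝ → ℝ → ℝ) (u : ℝ) : ℝ :=
  derivWithin (meanEnergyGain P m Γ c u) (Ici 0) 0

/-- The rate of change of the momentum of the left gas, given that the
piston has velocity `u`. -/
def momentumRate {Ω : Type*} [MeasurableSpace Ω] (P : Measure Ω) (m : ℝ)
    (Γ : Ω → Set (ℝ × ℝ)) (c : ℝ → Ω → ℝ × ℝ → ℝ → ℝ) (u : ℝ) : ℝ :=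
  derivWithin (meanMomentumGain P m Γ c u) (Ici 0) 0

/-- The means and derivatives that enter the definition of the heat flow exist. -/
structure HeatFlowExists {Ω : Type*} [MeasurableSpace Ω] (P : Measure Ω) (m Vbar : ℝ)
    (Γ : Ω → Set (ℝ × ℝ)) (c : ℝ → Ω → ℝ × ℝ → ℝ → ℝ) (μ : Measure ℝ) : Prop where
  integrable_energy : ∀ u ∈ Icc (-Vbar) Vbar, ∀ t, 0 ≤ t →
    Integrable (fun ω => leftEnergyGain m (Γ ω) (c u ω) t) P
  integrable_momentum : ∀ u ∈ Icc (-Vbar) Vbar, ∀ t, 0 ≤ t →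
    Integrable (fun ω => leftMomentumGain m (Γ ω) (c u ω) t) P
  differentiable_energy : ∀ u ∈ Icc (-Vbar) Vbar,
    DifferentiableWithinAt ℝ (meanEnergyGain P m Γ c u) (Ici 0) 0
  differentiable_momentum : ∀ u ∈ Icc (-Vbar) Vbar,
    DifferentiableWithinAt ℝ (meanMomentumGain P m Γ c u) (Ici 0) 0
  integrable_energyRate : Integrable (energyRate P m Γ c) μ
  integrable_momentumRate : Integrable (momentumRate P m Γ c) μ
  integrable_velocity : Integrable (fun w : ℝ => w) μ

/-- The heat flow from right to left: the average energy rate of the left gas, less the product of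
its average momentum rate and the average velocity of the piston. Averages are over `μ`. -/
def heatFlow {Ω : Type*} [MeasurableSpace Ω] (P : Measure Ω) (m : ℝ)
    (Γ : Ω → Set (ℝ × ℝ)) (c : ℝ → Ω → ℝ × ℝ → ℝ → ℝ) (μ : Measure ℝ) : ℝ :=
  (∫ u, energyRate P m Γ c u ∂μ) - (∫ u, momentumRate P m Γ c u ∂μ) * ∫ w, w ∂μ

end Piston

end

/-! Write a = 2m/(M+m), so that a collision takes the piston from u to u + a(v - u) before
reflection, and let b_k be the moments of the stationary measure μ. Two ingredients determine the
heat flow to first order in a.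

Short times. The cutoff makes an atom leave a collision faster than the piston can follow, so each
atom meets the piston at most once, and up to time t only atoms that start within distance O(t) can
do so. Their number is Poisson with mean O(t). The event of two or more such atoms contributes
O(t²), and the effect of a single one is explicit (`IsMotion.single_atom`). By Campbell's formula
mean changes are t times a collision rate up to O(t²), uniformly in u
(`IsPoissonProcess.abs_integral_sub_le`, `abs_integral_sub_rate_le`). Hence the energy and momentum
rates are polynomials in u with coefficients built from the F_k^-, and the heat flow is an explicit
expression in b₁, b₂, b₃ (`heatFlow_eq`).

Stationarity. The μ-mean of φ(W t) does not depend on t, so the mean collision rate of φ vanishes;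
`IsStationary.integral_nonneg_of_rate_le` is the one-sided form. The test functions u, u², u³, u⁴
give `IsStationary.momentRelations`. For Q₂ = 0 the drift of the piston is a(-2Q₁u + Q₀u²) apart
from reflection. It is restoring because Q₁ > 0 and Vbar < vmin/3, whence b₂ = O(a) and b₄ = O(a²).
Reflection acts only for |u| ≥ Vbar/2, so it costs O(a u⁴) per collision, which is O(a²) in mean
after the common factor a is divided out. The relations for u and u³ then give b₁ = O(a) and b₃ =
O(a²), and the one for u² gives b₂ = aQ₃/(4Q₁) + O(a²) (`moments_isBigO`).

In the heat flow the terms b₁F₂^- cancel between energy and momentum. What remains at first order is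
m·a(Q₃F₁^- - Q₁F₃^-)/Q₁, and a = 2ε + O(ε²). -/

namespace Piston

/-! ### Right-continuous step functions -/

/-- `f` is, at nonnegative times, a right-continuous step function. -/
structure IsStep (f : ℝ → ℝ) : Prop where
  right : ∀ t, 0 ≤ t → ∀ᶠ s in 𝓝[>] t, f s = f t
  left : ∀ t, 0 < t → ∃ V, ∀ᶠ s in 𝓝[<] t, f s = V

theorem integrableAtFilter_nhdsGT {f : ℝ → ℝ} {t V : ℝ} (h : ∀ᶠ s in 𝓝[>] t, f s = V) :
    IntegrableAtFilter f (𝓝[>] t) := by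
  obtain ⟨b, hb, hs⟩ := mem_nhdsGT_iff_exists_Ioo_subset.1 h
  refine ⟨Ioo t b, Ioo_mem_nhdsGT hb, ?_⟩
  exact (integrableOn_const (C := V) (by simp) (by simp)).congr_fun
    (fun s h => (hs h).symm) measurableSet_Ioo

theorem integrableAtFilter_nhdsLT {f : ℝ → ℝ} {t V : ℝ} (h : ∀ᶠ s in 𝓝[<] t, f s = V) :
    IntegrableAtFilter f (𝓝[<] t) := by
  obtain ⟨b, hb, hs⟩ := mem_nhdsLT_iff_exists_Ioo_subset.1 h
  refine ⟨Ioo b t, Ioo_mem_nhdsLT hb, ?_⟩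
  exact (integrableOn_const (C := V) (by simp) (by simp)).congr_fun
    (fun s h => (hs h).symm) measurableSet_Ioo

theorem integrableAtFilter_pure (f : ℝ → ℝ) (t : ℝ) : IntegrableAtFilter f (pure t) :=
  ⟨{t}, by simp, by simp [integrableOn_singleton_iff]⟩

/-- One-sided constancy at each point gives local integrability, and compactness of [0, b] does the
rest. At 0 only the right side matters, since nothing is assumed at negative times. -/
theorem IsStep.integrableOn {f : ℝ → ℝ} (hf : IsStep f) (b : ℝ) : IntegrableOn f (Icc 0 b) := by
  refine LocallyIntegrableOn.integrableOn_isCompact (fun t ht => ?_) isCompact_Icc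
  have hr := integrableAtFilter_nhdsGT (hf.right t ht.1)
  have hp := integrableAtFilter_pure f t
  rcases ht.1.eq_or_lt with h0 | h0
  · subst h0
    refine IntegrableAtFilter.filter_mono ?_ (IntegrableAtFilter.sup_iff.2 ⟨hp, hr⟩)
    rw [← nhdsWithin_singleton, ← nhdsWithin_union]
    refine nhdsWithin_mono _ fun s hs => ?_
    rcases hs.1.eq_or_lt with h | h
    · exact Or.inl h.symm
    · exact Or.inr h
  · obtain ⟨V, hV⟩ := hf.left t h0
    refine IntegrableAtFilter.filter_mono ?_ (IntegrableAtFilter.sup_iff.2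
      ⟨integrableAtFilter_nhdsLT hV, IntegrableAtFilter.sup_iff.2 ⟨hp, hr⟩⟩)
    rw [← nhdsWithin_singleton, ← nhdsWithin_union, ← nhdsWithin_union]
    refine nhdsWithin_mono _ fun s hs => ?_
    rcases lt_trichotomy s t with h | h | h
    · exact Or.inl h
    · exact Or.inr (Or.inl h)
    · exact Or.inr (Or.inr h)

theorem IsStep.intervalIntegrable {f : ℝ → ℝ} (hf : IsStep f) {a b : ℝ} (ha : 0 ≤ a)
    (hb : 0 ≤ b) : IntervalIntegrable f volume a b := by
  refine IntegrableOn.intervalIntegrable ((hf.integrableOn (max a b)).mono_set ?_)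
  intro s hs
  rw [mem_uIcc] at hs
  constructor
  · rcases hs with h | h <;> linarith
  · rcases hs with h | h
    · exact h.2.trans (le_max_right _ _)
    · exact h.2.trans (le_max_left _ _)

theorem IsStep.integral_sub {f : ℝ → ℝ} (hf : IsStep f) {a b : ℝ} (ha : 0 ≤ a) (hb : 0 ≤ b) :
    (∫ s in (0 : ℝ)..b, f s) - ∫ s in (0 : ℝ)..a, f s = ∫ s in a..b, f s :=
  intervalIntegral.integral_interval_sub_left (hf.intervalIntegrable le_rfl hb)
    (hf.intervalIntegrable le_rfl ha)

theorem IsStep.continuousOn_integral {f : ℝ → ℝ} (hf : IsStep f) (b : ℝ) (hb : 0 ≤ b) :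
    ContinuousOn (fun t => ∫ s in (0 : ℝ)..t, f s) (Icc 0 b) := by
  have := intervalIntegral.continuousOn_primitive_interval (f := f) (a := 0) (b := b)
    (μ := volume) (by rw [uIcc_of_le hb]; exact hf.integrableOn b)
  rwa [uIcc_of_le hb] at this

theorem integral_eq_of_eqOn_Ico {f : ℝ → ℝ} {a b V : ℝ} (hab : a ≤ b)
    (h : ∀ s ∈ Ico a b, f s = V) : ∫ s in a..b, f s = V * (b - a) := by
  rw [intervalIntegral.integral_of_le hab, integral_Ioc_eq_integral_Ioo,
    setIntegral_congr_fun measurableSet_Ioo (g := fun _ => V)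
      (fun s hs => h s (Ioo_subset_Ico_self hs))]
  simp [hab, mul_comm]

theorem abs_integral_le_of_Ico {f : ℝ → ℝ} {a b K : ℝ} (hab : a ≤ b)
    (h : ∀ s ∈ Ico a b, |f s| ≤ K) : |∫ s in a..b, f s| ≤ K * (b - a) := by
  rw [intervalIntegral.integral_of_le hab, integral_Ioc_eq_integral_Ioo]
  have := norm_setIntegral_le_of_norm_le_const (μ := volume) (s := Ioo a b) (f := f) (C := K)
    (by simp) (fun s hs => h s (Ioo_subset_Ico_self hs))
  simpa [Measure.real, hab] using this

/-- The hypotheses make `f` continuous with zero right derivative, so the mean value theorem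
applies; no count of the jumps is needed. -/
theorem eq_of_locally_eq {f : ℝ → ℝ} {a b : ℝ}
    (hr : ∀ t ∈ Ico a b, ∀ᶠ s in 𝓝[>] t, f s = f t)
    (hl : ∀ t ∈ Ioc a b, ∀ᶠ s in 𝓝[<] t, f s = f t) : ∀ t ∈ Icc a b, f t = f a := by
  apply constant_of_has_deriv_right_zero
  · intro t ht
    have h1 : t < b → ContinuousWithinAt f (Ioi t) t := fun h =>
      (tendsto_const_nhds (x := f t)).congr'
        ((hr t ⟨ht.1, h⟩).mono fun s hs => hs.symm)
    have h2 : a < t → ContinuousWithinAt f (Iio t) t := fun h =>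
      (tendsto_const_nhds (x := f t)).congr'
        ((hl t ⟨h, ht.2⟩).mono fun s hs => hs.symm)
    have h3 : ContinuousWithinAt f (Icc a b ∩ Ioi t) t := by
      rcases ht.2.eq_or_lt with h | h
      · have : Icc a b ∩ Ioi t = ∅ := by
          ext s; simp only [mem_inter_iff, mem_Icc, mem_Ioi, mem_empty_iff_false, iff_false]
          rintro ⟨h4, h5⟩; linarith [h4.2]
        rw [this]; simp [ContinuousWithinAt]
      · exact (h1 h).mono inter_subset_right
    have h4 : ContinuousWithinAt f (Icc a b ∩ Iio t) t := by
      rcases ht.1.eq_or_lt with h | h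
      · have : Icc a b ∩ Iio t = ∅ := by
          ext s; simp only [mem_inter_iff, mem_Icc, mem_Iio, mem_empty_iff_false, iff_false]
          rintro ⟨h4, h5⟩; linarith [h4.1]
        rw [this]; simp [ContinuousWithinAt]
      · exact (h2 h).mono inter_subset_right
    refine ((h3.union h4).union (continuousWithinAt_singleton (x := t))).mono fun s hs => ?_
    rcases lt_trichotomy s t with h | h | h
    · exact Or.inl (Or.inr ⟨hs, h⟩)
    · exact Or.inr h
    · exact Or.inl (Or.inl ⟨hs, h⟩)
  · intro t ht
    refine (hasDerivWithinAt_const t (Ici t) (f t)).congr_of_eventuallyEq ?_ rfl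
    rw [← Ioi_insert]
    rw [nhdsWithin_insert]
    exact eventually_sup.2 ⟨rfl, hr t ht⟩

theorem exists_Ico_of_eventually_nhdsGT {p : ℝ → Prop} {t : ℝ} (h : ∀ᶠ s in 𝓝[>] t, p s) :
    ∃ d, t < d ∧ ∀ s ∈ Ioo t d, p s := by
  obtain ⟨b, hb, hs⟩ := mem_nhdsGT_iff_exists_Ioo_subset.1 h
  exact ⟨b, hb, hs⟩

theorem eventually_nhdsLT_of_Ico {p : ℝ → Prop} {a t : ℝ} (hat : a < t)
    (h : ∀ s ∈ Ico a t, p s) : ∀ᶠ s in 𝓝[<] t, p s := by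
  filter_upwards [Ico_mem_nhdsLT hat] with s hs using h s hs

/-! ### Parameters -/

/-- The masses, the cutoff of the piston and the range of the atomic velocities: the cutoff
prevents recollisions, and one collision changes the velocity of the piston by at most
`Vbar / 2`. -/
structure Admissible (m M Vbar vmin vmax : ℝ) : Prop where
  m_pos : 0 < m
  M_pos : 0 < M
  Vbar_pos : 0 < Vbar
  vmin_pos : 0 < vmin
  vmin_lt : vmin < vmax
  cutoff : Vbar < vMax m M vmin
  small : 2 * m / (M + m) * (vmax + Vbar) ≤ Vbar / 2

namespace Admissible

variable {m M Vbar vmin vmax : ℝ}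

theorem cutoff_mul (h : Admissible m M Vbar vmin vmax) :
    Vbar * (3 * M + m) < (M - m) * vmin := by
  have h1 := h.cutoff
  have h2 : 0 < 3 * M + m := by linarith [h.m_pos, h.M_pos]
  rw [vMax, div_mul_eq_mul_div, lt_div_iff₀ h2] at h1
  exact h1

/-- The factor (M - m)/(3M + m) is below 1/3. The value 1/3 is used again to keep the drift of the
piston restoring. -/
theorem three_mul_Vbar_lt (h : Admissible m M Vbar vmin vmax) : 3 * Vbar < vmin := by
  have h1 := h.cutoff_mul
  have hm := h.m_pos
  have hM := h.M_pos
  have hV := h.Vbar_pos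
  have hv := h.vmin_pos
  by_contra hcon
  push Not at hcon
  nlinarith [mul_pos hm hV, mul_pos hm hv]

theorem Vbar_lt (h : Admissible m M Vbar vmin vmax) : Vbar < vmin := by
  linarith [h.three_mul_Vbar_lt, h.Vbar_pos]

/-- This is where the form of `vMax` comes from: the worst case σv = vmin, σV = Vbar gives -(M -
m)vmin + 2M·Vbar < -(M + m)Vbar, which is the cutoff condition. The sign σ treats both sides at
once. -/
theorem atomAfter_lt (h : Admissible m M Vbar vmin vmax) {σ V v : ℝ} (hσ : σ = 1 ∨ σ = -1)
    (hV : |V| ≤ Vbar) (hv : vmin < σ * v) : σ * atomAfter m M V v < -Vbar := by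
  have h1 := h.cutoff_mul
  have hm := h.m_pos
  have hM := h.M_pos
  have hs : 0 < M + m := by linarith
  have hσV : σ * V ≤ Vbar := by
    rcases hσ with rfl | rfl
    · linarith [(abs_le.1 hV).2]
    · linarith [(abs_le.1 hV).1]
  have hMm : 0 < M - m := by
    by_contra hcon
    push Not at hcon
    nlinarith [h.Vbar_pos, h.vmin_pos]
  have e : σ * atomAfter m M V v = (-(M - m) * (σ * v) + 2 * M * (σ * V)) / (M + m) := by
    unfold atomAfter; field_simp
  rw [e, div_lt_iff₀ hs]
  nlinarith [mul_lt_mul_of_pos_left hv hMm, mul_le_mul_of_nonneg_left hσV hM.le]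

theorem pistonAfter_eq (h : Admissible m M Vbar vmin vmax) (V v : ℝ) :
    pistonAfter m M V v = V + 2 * m / (M + m) * (v - V) := by
  have hs : M + m ≠ 0 := by linarith [h.m_pos, h.M_pos]
  unfold pistonAfter; field_simp; ring

theorem ratio_pos (h : Admissible m M Vbar vmin vmax) : 0 < 2 * m / (M + m) := by
  have := h.m_pos; have := h.M_pos; positivity

theorem abs_pistonAfter_sub_le (h : Admissible m M Vbar vmin vmax) {V v : ℝ} (hV : |V| ≤ Vbar)
    (hv : |v| ≤ vmax) :
    |pistonAfter m M V v - V| ≤ 2 * m / (M + m) * (vmax + Vbar) := by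
  rw [h.pistonAfter_eq, add_sub_cancel_left, abs_mul, abs_of_pos h.ratio_pos]
  exact mul_le_mul_of_nonneg_left ((abs_sub _ _).trans (add_le_add hv hV)) h.ratio_pos.le

/-- A jump of at most Vbar/2 overshoots the cutoff by at most Vbar/2, so one reflection brings the
velocity back into the interval. -/
theorem abs_reflectVel_le (h : Admissible m M Vbar vmin vmax) {V v : ℝ} (hV : |V| ≤ Vbar)
    (hv : |v| ≤ vmax) : |reflectVel Vbar (pistonAfter m M V v)| ≤ Vbar := by
  have h1 := (h.abs_pistonAfter_sub_le hV hv).trans h.small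
  rw [abs_le] at h1 hV ⊢
  have := h.Vbar_pos
  unfold reflectVel
  split_ifs <;> constructor <;> linarith

end Admissible

/-! ### The motion for a given initial configuration -/

/-- The position of the piston relative to the atom that starts from `z`. -/
noncomputable def gap (W : ℝ → ℝ) (c : ℝ × ℝ → ℝ → ℝ) (z : ℝ × ℝ) (t : ℝ) : ℝ :=
  (∫ s in (0 : ℝ)..t, W s) - (z.1 + ∫ s in (0 : ℝ)..t, c z s)

theorem meets_iff {W : ℝ → ℝ} {c : ℝ × ℝ → ℝ → ℝ} {z : ℝ × ℝ} {t : ℝ} :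
    Meets W c z t ↔ gap W c z t = 0 := by
  rw [Meets, gap, sub_eq_zero, eq_comm]

theorem gap_zero (W : ℝ → ℝ) (c : ℝ × ℝ → ℝ → ℝ) (z : ℝ × ℝ) : gap W c z 0 = -z.1 := by
  simp [gap]

theorem exists_first_zero {f : ℝ → ℝ} {a b : ℝ} (hab : a ≤ b) (hf : ContinuousOn f (Icc a b))
    (hb : f b = 0) : ∃ τ ∈ Icc a b, f τ = 0 ∧ ∀ s ∈ Ico a τ, f s ≠ 0 := by
  have hc : IsCompact (Icc a b ∩ f ⁻¹' {0}) :=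
    isCompact_Icc.of_isClosed_subset
      (hf.preimage_isClosed_of_isClosed isClosed_Icc isClosed_singleton) inter_subset_left
  obtain ⟨τ, hτ, hl⟩ := hc.exists_isLeast ⟨b, ⟨hab, le_rfl⟩, hb⟩
  refine ⟨τ, hτ.1, hτ.2, fun s hs h0 => ?_⟩
  exact absurd (hl ⟨⟨hs.1, hs.2.le.trans hτ.1.2⟩, h0⟩) (not_le.2 hs.2)

namespace IsMotion

variable {m M Vbar u vmin vmax : ℝ} {Γ : Set (ℝ × ℝ)} {W : ℝ → ℝ} {c : ℝ × ℝ → ℝ → ℝ}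

theorem isStep_piston (h : IsMotion m M Vbar Γ u W c) : IsStep W where
  right := h.piston_right
  left t ht := by
    by_cases hm : ∀ z ∈ Γ, ¬ Meets W c z t
    · exact ⟨_, h.piston_free t ht hm⟩
    · push Not at hm
      obtain ⟨z, hz, hzt⟩ := hm
      obtain ⟨V, v, hV, -⟩ := h.collision z hz t ht hzt
      exact ⟨V, hV.mono fun s hs => hs.1⟩

theorem isStep_atom (h : IsMotion m M Vbar Γ u W c) {z : ℝ × ℝ} (hz : z ∈ Γ) :
    IsStep (c z) where
  right := h.atom_right z hz
  left t ht := by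
    by_cases hm : Meets W c z t
    · obtain ⟨V, v, hV, -⟩ := h.collision z hz t ht hm
      exact ⟨v, hV.mono fun s hs => hs.2⟩
    · exact ⟨_, h.atom_free z hz t ht hm⟩

theorem continuousOn_gap (h : IsMotion m M Vbar Γ u W c) {z : ℝ × ℝ} (hz : z ∈ Γ) {a b : ℝ}
    (ha : 0 ≤ a) (hb : 0 ≤ b) : ContinuousOn (gap W c z) (Icc a b) :=
  ((h.isStep_piston.continuousOn_integral b hb).sub
    (continuousOn_const.add ((h.isStep_atom hz).continuousOn_integral b hb))).mono
      (Icc_subset_Icc_left ha)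

theorem atom_const (h : IsMotion m M Vbar Γ u W c) {z : ℝ × ℝ} (hz : z ∈ Γ) {a b : ℝ}
    (ha : 0 ≤ a) (hm : ∀ s ∈ Ioc a b, ¬ Meets W c z s) : ∀ t ∈ Icc a b, c z t = c z a :=
  eq_of_locally_eq (fun t ht => h.atom_right z hz t (ha.trans ht.1))
    fun t ht => h.atom_free z hz t (ha.trans_lt ht.1) (hm t ht)

theorem atom_const_Ico (h : IsMotion m M Vbar Γ u W c) {z : ℝ × ℝ} (hz : z ∈ Γ) {a b : ℝ}
    (ha : 0 ≤ a) (hm : ∀ s ∈ Ioo a b, ¬ Meets W c z s) : ∀ t ∈ Ico a b, c z t = c z a :=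
  fun t ht => h.atom_const hz ha (fun s hs => hm s ⟨hs.1, hs.2.trans_lt ht.2⟩) t
    ⟨ht.1, le_rfl⟩

theorem piston_const (h : IsMotion m M Vbar Γ u W c) {a b : ℝ}
    (ha : 0 ≤ a) (hm : ∀ s ∈ Ioc a b, ∀ z ∈ Γ, ¬ Meets W c z s) : ∀ t ∈ Icc a b, W t = W a :=
  eq_of_locally_eq (fun t ht => h.piston_right t (ha.trans ht.1))
    fun t ht => h.piston_free t (ha.trans_lt ht.1) (hm t ht)

theorem piston_const_Ico (h : IsMotion m M Vbar Γ u W c) {a b : ℝ}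
    (ha : 0 ≤ a) (hm : ∀ s ∈ Ioo a b, ∀ z ∈ Γ, ¬ Meets W c z s) : ∀ t ∈ Ico a b, W t = W a :=
  fun t ht => h.piston_const ha (fun s hs => hm s ⟨hs.1, hs.2.trans_lt ht.2⟩) t
    ⟨ht.1, le_rfl⟩

/-- While the atom keeps its velocity, the gap changes at a rate bounded below. -/
theorem le_gap_sub (h : IsMotion m M Vbar Γ u W c) {z : ℝ × ℝ} (hz : z ∈ Γ) {σ a b k : ℝ}
    (hσ : σ = 1 ∨ σ = -1) (ha : 0 ≤ a) (hab : a ≤ b) (hW : ∀ s ∈ Ico a b, |W s| ≤ Vbar)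
    (hc : ∀ s ∈ Ico a b, c z s = k) :
    (-Vbar - σ * k) * (b - a) ≤ σ * gap W c z b - σ * gap W c z a := by
  have h1 := h.isStep_piston.integral_sub ha (ha.trans hab)
  have h2 := (h.isStep_atom hz).integral_sub ha (ha.trans hab)
  rw [integral_eq_of_eqOn_Ico hab hc] at h2
  have h3 := abs_integral_le_of_Ico hab hW
  rw [← h1, abs_le] at h3
  unfold gap
  rcases hσ with rfl | rfl <;> nlinarith [h3.1, h3.2]

/-- An atom that moves away from the piston faster than the cutoff never meets it. -/
theorem not_meets_of_escape (h : IsMotion m M Vbar Γ u W c) {z : ℝ × ℝ} (hz : z ∈ Γ)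
    {σ a T : ℝ} (hσ : σ = 1 ∨ σ = -1) (ha : 0 ≤ a) (hW : ∀ s ∈ Ico a T, |W s| ≤ Vbar)
    (hc : σ * c z a < -Vbar) (hg : 0 ≤ σ * gap W c z a) :
    ∀ t ∈ Ioc a T, ¬ Meets W c z t := by
  intro t ht hmt
  obtain ⟨d, had, hd⟩ := exists_Ico_of_eventually_nhdsGT (h.atom_right z hz a ha)
  have key : ∀ b ∈ Ioc a T, (∀ s ∈ Ico a b, c z s = c z a) → ¬ Meets W c z b := by
    intro b hb hcb hm
    have h1 := h.le_gap_sub hz hσ ha hb.1.le (fun s hs => hW s ⟨hs.1, hs.2.trans_le hb.2⟩) hcb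
    rw [meets_iff.1 hm] at h1
    have h2 : 0 < (-Vbar - σ * c z a) * (b - a) :=
      mul_pos (by linarith) (by linarith [hb.1])
    linarith
  have hcd : ∀ s ∈ Ico a d, c z s = c z a := by
    intro s hs
    rcases hs.1.eq_or_lt with h0 | h0
    · rw [h0]
    · exact hd s ⟨h0, hs.2⟩
  -- The gap may vanish at `a` itself. Meetings up to `s₀` are excluded because right-continuity
  -- keeps the velocity fixed there; beyond `s₀` the first zero of the gap is a meeting before which
  -- the velocity is still unchanged.
  set s₀ := min ((a + d) / 2) t with hs₀
  have h1 : a < s₀ := lt_min (by linarith) ht.1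
  have h2 : s₀ ≤ t := min_le_right _ _
  have h3 : s₀ < d := (min_le_left _ _).trans_lt (by linarith)
  have hs : ∀ s ∈ Ioc a s₀, ¬ Meets W c z s := fun s hs =>
    key s ⟨hs.1, (hs.2.trans h2).trans ht.2⟩
      (fun r hr => hcd r ⟨hr.1, hr.2.trans (hs.2.trans_lt h3)⟩)
  obtain ⟨τ, hτ, h0, hb⟩ := exists_first_zero h2
    (h.continuousOn_gap hz (by linarith) (by linarith [ht.1])) (meets_iff.1 hmt)
  refine key τ ⟨h1.trans_le hτ.1, hτ.2.trans ht.2⟩ (h.atom_const_Ico hz ha ?_) (meets_iff.2 h0)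
  intro s hsτ hms
  rcases le_or_gt s s₀ with h4 | h4
  · exact hs s ⟨hsτ.1, h4⟩ hms
  · exact hb s ⟨h4.le, hsτ.2⟩ (meets_iff.1 hms)

theorem exists_first_meeting (h : IsMotion m M Vbar Γ u W c) {z : ℝ × ℝ} (hz : z ∈ Γ)
    (hz1 : z.1 ≠ 0) {t : ℝ} (ht : 0 ≤ t) (hm : Meets W c z t) :
    ∃ τ ∈ Ioc 0 t, Meets W c z τ ∧ ∀ s ∈ Ioo 0 τ, ¬ Meets W c z s := by
  obtain ⟨τ, hτ, h0, hb⟩ := exists_first_zero ht (h.continuousOn_gap hz le_rfl ht)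
    (meets_iff.1 hm)
  refine ⟨τ, ⟨hτ.1.lt_of_ne ?_, hτ.2⟩, meets_iff.2 h0,
    fun s hs hms => hb s ⟨hs.1.le, hs.2⟩ (meets_iff.1 hms)⟩
  rintro rfl
  rw [gap_zero] at h0
  exact hz1 (by linarith)

/-- The sign σ is 1 for atoms that start on the left and -1 for those on the right. Then σ times the
gap is positive at time 0, and σv > 0 means motion towards the piston. -/
theorem exists_sign (x : ℝ) (hx : x ≠ 0) : ∃ σ : ℝ, (σ = 1 ∨ σ = -1) ∧ σ * x < 0 := by
  rcases hx.lt_or_gt with h | h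
  · exact ⟨1, Or.inl rfl, by linarith⟩
  · exact ⟨-1, Or.inr rfl, by linarith⟩

/-- The first meeting of an atom with the piston. -/
theorem first_meeting (h : IsMotion m M Vbar Γ u W c) (hp : Admissible m M Vbar vmin vmax)
    {z : ℝ × ℝ} (hz : z ∈ Γ) (hz2 : vmin < |z.2|) {σ τ : ℝ} (hσ : σ = 1 ∨ σ = -1)
    (hσz : σ * z.1 < 0) (hτ : 0 < τ) (hm : Meets W c z τ)
    (hfirst : ∀ s ∈ Ioo 0 τ, ¬ Meets W c z s) (hW : ∀ s ∈ Ico 0 τ, |W s| ≤ Vbar) :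
    vmin < σ * z.2 ∧ z.1 + z.2 * τ = (∫ s in (0 : ℝ)..τ, W s) ∧
      ∃ V, |V| ≤ Vbar ∧ (∀ᶠ s in 𝓝[<] τ, W s = V) ∧
        W τ = reflectVel Vbar (pistonAfter m M V z.2) ∧ c z τ = atomAfter m M V z.2 := by
  have hc : ∀ s ∈ Ico 0 τ, c z s = z.2 := fun s hs =>
    (h.atom_const_Ico hz le_rfl hfirst s hs).trans (h.atom_init z hz)
  have h1 : z.1 + z.2 * τ = ∫ s in (0 : ℝ)..τ, W s := by
    rw [← hm, integral_eq_of_eqOn_Ico hτ.le hc, sub_zero]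
  have h2 := h.le_gap_sub hz hσ le_rfl hτ.le hW hc
  rw [meets_iff.1 hm, gap_zero] at h2
  -- The gap has to shrink from -σ·z.1 > 0 to 0, which forces σ·z.2 > -Vbar; since |z.2| > vmin >
  -- Vbar, the value σ·z.2 then exceeds vmin.
  have h3 : vmin < σ * z.2 := by
    have h4 : -Vbar - σ * z.2 < 0 := by
      by_contra hcon
      push Not at hcon
      have := mul_nonneg hcon (sub_nonneg.2 hτ.le)
      nlinarith
    have := hp.Vbar_lt
    rcases hσ with rfl | rfl
    · rcases lt_abs.1 hz2 with h5 | h5 <;> linarith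
    · rcases lt_abs.1 hz2 with h5 | h5 <;> linarith
  obtain ⟨V, v, hV, hW', hc'⟩ := h.collision z hz τ hτ hm
  have hev : ∀ᶠ s in 𝓝[<] τ, |W s| ≤ Vbar ∧ c z s = z.2 :=
    eventually_nhdsLT_of_Ico hτ fun s hs => ⟨hW s hs, hc s hs⟩
  obtain ⟨s, hs1, hs2⟩ := (hV.and hev).exists
  have hv : v = z.2 := by rw [← hs1.2, hs2.2]
  subst hv
  exact ⟨h3, h1, V, hs1.1 ▸ hs2.1, hV.mono fun s hs => hs.1, hW', hc'⟩

/-- After its first meeting with the piston an atom does not meet it again. -/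
theorem not_meets_after_first (h : IsMotion m M Vbar Γ u W c)
    (hp : Admissible m M Vbar vmin vmax)
    {z : ℝ × ℝ} (hz : z ∈ Γ) (hz1 : z.1 ≠ 0) (hz2 : vmin < |z.2|) {τ T : ℝ} (hτ : 0 < τ)
    (hτT : τ ≤ T) (hm : Meets W c z τ)
    (hfirst : ∀ s ∈ Ioo 0 τ, ¬ Meets W c z s) (hW : ∀ s ∈ Ico 0 T, |W s| ≤ Vbar) :
    ∀ t ∈ Ioc τ T, ¬ Meets W c z t := by
  obtain ⟨σ, hσ, hσz⟩ := exists_sign z.1 hz1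
  obtain ⟨h1, -, V, hV, -, -, hc⟩ := h.first_meeting hp hz hz2 hσ hσz hτ hm hfirst
    fun s hs => hW s ⟨hs.1, hs.2.trans_le hτT⟩
  refine h.not_meets_of_escape hz hσ hτ.le (fun s hs => hW s ⟨hτ.le.trans hs.1, hs.2⟩) ?_ ?_
  · rw [hc]; exact hp.atomAfter_lt hσ hV h1
  · rw [meets_iff.1 hm, mul_zero]

/-- Each meeting is the first one. -/
theorem not_meets_before (h : IsMotion m M Vbar Γ u W c) (hp : Admissible m M Vbar vmin vmax)
    {z : ℝ × ℝ} (hz : z ∈ Γ) (hz1 : z.1 ≠ 0) (hz2 : vmin < |z.2|) {t : ℝ} (ht : 0 < t)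
    (hm : Meets W c z t) (hW : ∀ s ∈ Ico 0 t, |W s| ≤ Vbar) :
    ∀ s ∈ Ioo 0 t, ¬ Meets W c z s := by
  obtain ⟨τ, hτ, hmτ, hf⟩ := h.exists_first_meeting hz hz1 ht.le hm
  rcases hτ.2.eq_or_lt with h1 | h1
  · exact h1 ▸ hf
  · exact absurd hm
      (h.not_meets_after_first hp hz hz1 hz2 hτ.1 hτ.2 hmτ hf hW t ⟨h1, le_rfl⟩)

/-- The velocity of the piston respects the cutoff. -/
theorem abs_piston_le (h : IsMotion m M Vbar Γ u W c) (hp : Admissible m M Vbar vmin vmax)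
    (hΓ : ∀ z ∈ Γ, z.1 ≠ 0 ∧ vmin < |z.2| ∧ |z.2| < vmax) (hu : |u| ≤ Vbar) :
    ∀ t, 0 ≤ t → |W t| ≤ Vbar := by
  by_contra hcon
  push Not at hcon
  -- The analysis of collisions presupposes the bound being proved, so it is bootstrapped: before
  -- the infimum `T` of the violations the bound holds, hence each collision at `T` is a first one
  -- and respects the cutoff, and right-continuity carries the bound past `T`.
  set S := {t : ℝ | 0 ≤ t ∧ Vbar < |W t|} with hS
  have hne : S.Nonempty := hcon
  have hbdd : BddBelow S := ⟨0, fun t ht => ht.1⟩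
  set T := sInf S with hT
  have hT0 : 0 ≤ T := le_csInf hne fun t ht => ht.1
  have hW : ∀ s ∈ Ico 0 T, |W s| ≤ Vbar := by
    intro s hs
    by_contra hc
    exact absurd (csInf_le hbdd ⟨hs.1, not_le.1 hc⟩) (not_le.2 hs.2)
  have hWT : |W T| ≤ Vbar := by
    rcases hT0.eq_or_lt with h0 | h0
    · rw [← h0, h.piston_init]; exact hu
    by_cases hm : ∀ z ∈ Γ, ¬ Meets W c z T
    · obtain ⟨s, hs1, hs2⟩ := ((h.piston_free T h0 hm).and
        (eventually_nhdsLT_of_Ico h0 hW)).exists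
      exact hs1 ▸ hs2
    · push Not at hm
      obtain ⟨z, hz, hzT⟩ := hm
      obtain ⟨hz1, hz2, hz3⟩ := hΓ z hz
      obtain ⟨σ, hσ, hσz⟩ := exists_sign z.1 hz1
      obtain ⟨-, -, V, hV, -, hWV, -⟩ := h.first_meeting hp hz hz2 hσ hσz h0 hzT
        (h.not_meets_before hp hz hz1 hz2 h0 hzT hW) hW
      rw [hWV]
      exact hp.abs_reflectVel_le hV hz3.le
  obtain ⟨d, hd, hd'⟩ := exists_Ico_of_eventually_nhdsGT (h.piston_right T hT0)
  have : d ≤ T := by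
    refine le_csInf hne fun t ht => ?_
    by_contra hc
    push Not at hc
    rcases (csInf_le hbdd ht).eq_or_lt with h1 | h1
    · exact absurd hWT (not_le.2 (by rw [hT, h1]; exact ht.2))
    · have := ht.2
      rw [hd' t ⟨h1, hc⟩] at this
      exact absurd hWT (not_le.2 this)
  linarith

end IsMotion

/-! ### Atoms that can reach the piston in a short time -/

/-- The atoms that can meet the piston up to time `t` start in this set. -/
def window (vmax Vbar t : ℝ) : Set (ℝ × ℝ) :=
  Icc (-((vmax + Vbar) * t)) ((vmax + Vbar) * t) ×ˢ univ

/-- The atom that starts from `z` reaches, up to time `t`, a piston of constant velocity `u`. -/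
def Hit (vmin vmax u t : ℝ) (z : ℝ × ℝ) : Prop :=
  (z.1 < 0 ∧ z.2 ∈ Ioo vmin vmax ∧ -((z.2 - u) * t) ≤ z.1) ∨
    (0 < z.1 ∧ z.2 ∈ Ioo (-vmax) (-vmin) ∧ z.1 ≤ (u - z.2) * t)

namespace IsMotion

variable {m M Vbar u vmin vmax : ℝ} {Γ : Set (ℝ × ℝ)} {W : ℝ → ℝ} {c : ℝ × ℝ → ℝ → ℝ}

/-- Up to its first meeting the atom moves with speed below vmax and the piston with speed at most
Vbar, so their initial distance is at most (vmax + Vbar)t. -/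
theorem mem_window_of_meets (h : IsMotion m M Vbar Γ u W c)
    (hp : Admissible m M Vbar vmin vmax)
    (hΓ : ∀ z ∈ Γ, z.1 ≠ 0 ∧ vmin < |z.2| ∧ |z.2| < vmax) (hu : |u| ≤ Vbar) {z : ℝ × ℝ}
    (hz : z ∈ Γ) {s t : ℝ} (hs : s ∈ Ioc 0 t) (hm : Meets W c z s) :
    z ∈ window vmax Vbar t := by
  have hW : ∀ r ∈ Ico 0 s, |W r| ≤ Vbar := fun r hr => h.abs_piston_le hp hΓ hu r hr.1
  obtain ⟨hz1, hz2, hz3⟩ := hΓ z hz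
  obtain ⟨σ, hσ, hσz⟩ := exists_sign z.1 hz1
  obtain ⟨-, h1, -⟩ := h.first_meeting hp hz hz2 hσ hσz hs.1 hm
    (h.not_meets_before hp hz hz1 hz2 hs.1 hm hW) hW
  have h2 := abs_integral_le_of_Ico hs.1.le hW
  rw [← h1, sub_zero, abs_le] at h2
  rw [abs_lt] at hz3
  have h3 : 0 ≤ (vmax + Vbar) * (t - s) :=
    mul_nonneg (by linarith [hp.vmin_lt, hp.vmin_pos, hp.Vbar_pos]) (sub_nonneg.2 hs.2)
  have h4 := mul_lt_mul_of_pos_right hz3.1 hs.1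
  have h5 := mul_lt_mul_of_pos_right hz3.2 hs.1
  refine ⟨⟨?_, ?_⟩, mem_univ _⟩ <;> nlinarith [h2.1, h2.2]

theorem atom_eq_of_not_meets (h : IsMotion m M Vbar Γ u W c) {z : ℝ × ℝ} (hz : z ∈ Γ) {t : ℝ}
    (ht : 0 ≤ t) (hm : ∀ s ∈ Ioc 0 t, ¬ Meets W c z s) : c z t = z.2 :=
  (h.atom_const hz le_rfl hm t ⟨ht, le_rfl⟩).trans (h.atom_init z hz)

theorem atom_eq_of_meets (h : IsMotion m M Vbar Γ u W c)
    (hp : Admissible m M Vbar vmin vmax)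
    (hΓ : ∀ z ∈ Γ, z.1 ≠ 0 ∧ vmin < |z.2| ∧ |z.2| < vmax) (hu : |u| ≤ Vbar) {z : ℝ × ℝ}
    (hz : z ∈ Γ) {s t : ℝ} (hs : s ∈ Ioc 0 t) (hm : Meets W c z s) :
    c z t = c z s ∧ ∀ r ∈ Ioc s t, ¬ Meets W c z r := by
  have hW : ∀ r ∈ Ico 0 t, |W r| ≤ Vbar := fun r hr => h.abs_piston_le hp hΓ hu r hr.1
  obtain ⟨hz1, hz2, hz3⟩ := hΓ z hz
  have h1 := h.not_meets_after_first hp hz hz1 hz2 hs.1 hs.2 hm (h.not_meets_before hp hz hz1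
    hz2 hs.1 hm fun r hr => hW r ⟨hr.1, hr.2.trans_le hs.2⟩) hW
  exact ⟨h.atom_const hz hs.1.le h1 t ⟨hs.2, le_rfl⟩, h1⟩

/-- The velocity of an atom is its initial one or the velocity after one collision. -/
theorem atom_cases (h : IsMotion m M Vbar Γ u W c)
    (hp : Admissible m M Vbar vmin vmax)
    (hΓ : ∀ z ∈ Γ, z.1 ≠ 0 ∧ vmin < |z.2| ∧ |z.2| < vmax) (hu : |u| ≤ Vbar) {z : ℝ × ℝ}
    (hz : z ∈ Γ) {t : ℝ} (ht : 0 ≤ t) :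
    c z t = z.2 ∨ ∃ V, |V| ≤ Vbar ∧ c z t = atomAfter m M V z.2 := by
  by_cases hm : ∃ s ∈ Ioc 0 t, Meets W c z s
  · obtain ⟨s, hs, hms⟩ := hm
    have hW : ∀ r ∈ Ico 0 s, |W r| ≤ Vbar := fun r hr => h.abs_piston_le hp hΓ hu r hr.1
    obtain ⟨hz1, hz2, hz3⟩ := hΓ z hz
    obtain ⟨σ, hσ, hσz⟩ := exists_sign z.1 hz1
    obtain ⟨-, -, V, hV, -, -, hc⟩ := h.first_meeting hp hz hz2 hσ hσz hs.1 hms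
      (h.not_meets_before hp hz hz1 hz2 hs.1 hms hW) hW
    exact Or.inr ⟨V, hV, (h.atom_eq_of_meets hp hΓ hu hz hs hms).1.trans hc⟩
  · push Not at hm
    exact Or.inl (h.atom_eq_of_not_meets hz ht hm)

theorem atom_eq_of_notMem_window (h : IsMotion m M Vbar Γ u W c)
    (hp : Admissible m M Vbar vmin vmax)
    (hΓ : ∀ z ∈ Γ, z.1 ≠ 0 ∧ vmin < |z.2| ∧ |z.2| < vmax) (hu : |u| ≤ Vbar) {z : ℝ × ℝ}
    (hz : z ∈ Γ) {t : ℝ} (ht : 0 ≤ t) (hzw : z ∉ window vmax Vbar t) : c z t = z.2 :=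
  h.atom_eq_of_not_meets hz ht fun _ hs hm => hzw (h.mem_window_of_meets hp hΓ hu hz hs hm)

theorem piston_eq_of_empty (h : IsMotion m M Vbar Γ u W c)
    (hp : Admissible m M Vbar vmin vmax)
    (hΓ : ∀ z ∈ Γ, z.1 ≠ 0 ∧ vmin < |z.2| ∧ |z.2| < vmax) (hu : |u| ≤ Vbar)
    {t : ℝ} (ht : 0 ≤ t) (he : Γ ∩ window vmax Vbar t = ∅) : W t = u := by
  refine (h.piston_const le_rfl (fun s hs z hz hm => ?_) t ⟨ht, le_rfl⟩).trans h.piston_init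
  exact eq_empty_iff_forall_notMem.1 he z ⟨hz, h.mem_window_of_meets hp hΓ hu hz hs hm⟩

/-- The motion when a single atom can reach the piston. -/
theorem single_atom (h : IsMotion m M Vbar Γ u W c)
    (hp : Admissible m M Vbar vmin vmax)
    (hΓ : ∀ z ∈ Γ, z.1 ≠ 0 ∧ vmin < |z.2| ∧ |z.2| < vmax) (hu : |u| ≤ Vbar)
    {t : ℝ} (ht : 0 ≤ t) {z : ℝ × ℝ} (he : Γ ∩ window vmax Vbar t = {z}) :
    (Hit vmin vmax u t z ∧ c z t = atomAfter m M u z.2 ∧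
      W t = reflectVel Vbar (pistonAfter m M u z.2)) ∨
    (¬ Hit vmin vmax u t z ∧ c z t = z.2 ∧ W t = u) := by
  have hz : z ∈ Γ := (he.symm ▸ mem_singleton z : z ∈ Γ ∩ window vmax Vbar t).1
  have hother : ∀ s ∈ Ioc 0 t, ∀ y ∈ Γ, Meets W c y s → y = z := fun s hs y hy hm =>
    (he ▸ (⟨hy, h.mem_window_of_meets hp hΓ hu hy hs hm⟩ : y ∈ Γ ∩ window vmax Vbar t) :
      y ∈ ({z} : Set (ℝ × ℝ)))
  obtain ⟨hz1, hz2, hz3⟩ := hΓ z hz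
  have hu' := abs_le.1 hu
  have hVv := hp.Vbar_lt
  by_cases hm : ∃ s ∈ Ioc 0 t, Meets W c z s
  · left
    obtain ⟨s, hs, hms⟩ := hm
    have hWa : ∀ r ∈ Ico 0 s, |W r| ≤ Vbar := fun r hr => h.abs_piston_le hp hΓ hu r hr.1
    have hbef := h.not_meets_before hp hz hz1 hz2 hs.1 hms hWa
    have hW : ∀ r ∈ Ico 0 s, W r = u := fun r hr =>
      (h.piston_const_Ico le_rfl (fun q hq y hy hmy => hbef q hq
        (hother q ⟨hq.1, hq.2.le.trans hs.2⟩ y hy hmy ▸ hmy)) r hr).trans h.piston_init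
    obtain ⟨σ, hσ, hσz⟩ := exists_sign z.1 hz1
    obtain ⟨h1, h2, V, hV, hVev, hWs, hcs⟩ := h.first_meeting hp hz hz2 hσ hσz hs.1 hms hbef hWa
    obtain ⟨r, hr1, hr2⟩ := (hVev.and (eventually_nhdsLT_of_Ico hs.1 hW)).exists
    have hVu : V = u := hr1.symm.trans hr2
    subst hVu
    rw [integral_eq_of_eqOn_Ico hs.1.le hW, sub_zero] at h2
    obtain ⟨h3, h4⟩ := h.atom_eq_of_meets hp hΓ hu hz hs hms
    refine ⟨?_, h3.trans hcs, ?_⟩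
    · rw [abs_lt] at hz3
      rcases hσ with rfl | rfl
      · left
        refine ⟨by linarith, ⟨by linarith, hz3.2⟩, ?_⟩
        have := mul_le_mul_of_nonneg_left hs.2 (show 0 ≤ z.2 - V by linarith)
        linarith
      · right
        refine ⟨by linarith, ⟨hz3.1, by linarith⟩, ?_⟩
        have := mul_le_mul_of_nonneg_left hs.2 (show 0 ≤ V - z.2 by linarith)
        linarith
    · rw [← hWs]
      refine h.piston_const hs.1.le (fun q hq y hy hmy => ?_) t ⟨hs.2, le_rfl⟩
      exact h4 q hq (hother q ⟨hs.1.trans hq.1, hq.2⟩ y hy hmy ▸ hmy)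
  · right
    push Not at hm
    have hW : ∀ r ∈ Icc 0 t, W r = u := fun r hr =>
      (h.piston_const le_rfl (fun q hq y hy hmy => hm q hq (hother q hq y hy hmy ▸ hmy)) r
        hr).trans h.piston_init
    refine ⟨fun hh => ?_, h.atom_eq_of_not_meets hz ht hm, hW t ⟨ht, le_rfl⟩⟩
    have hc : ∀ r ∈ Icc 0 t, c z r = z.2 := fun r hr =>
      (h.atom_const hz le_rfl hm r hr).trans (h.atom_init z hz)
    -- Without a meeting both paths are straight lines, and being hit says that these lines cross at
    -- an explicit time in (0, t].
    have hmeet : ∀ s ∈ Ioc 0 t, z.1 + z.2 * s = u * s → False := by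
      intro s hs he
      refine hm s hs ?_
      rw [Meets, integral_eq_of_eqOn_Ico hs.1.le fun r hr => hW r ⟨hr.1, hr.2.le.trans hs.2⟩,
        integral_eq_of_eqOn_Ico hs.1.le fun r hr => hc r ⟨hr.1, hr.2.le.trans hs.2⟩]
      simpa using he
    rcases hh with ⟨h1, h2, h3⟩ | ⟨h1, h2, h3⟩
    · have h4 : 0 < z.2 - u := by linarith [h2.1]
      refine hmeet (-z.1 / (z.2 - u)) ⟨div_pos (by linarith) h4, ?_⟩ (by field_simp; ring)
      rw [div_le_iff₀ h4]; linarith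
    · have h4 : 0 < u - z.2 := by linarith [h2.2]
      refine hmeet (z.1 / (u - z.2)) ⟨div_pos (by linarith) h4, ?_⟩ (by field_simp; ring)
      rw [div_le_iff₀ h4]; linarith

end IsMotion

/-! ### Bounds for the changes caused by the collisions -/

/-- Atoms outside `D` contribute nothing, so at most one summand survives; it counts only if that
atom starts on the left. -/
theorem tsum_single_window {Γ D : Set (ℝ × ℝ)} {F : ℝ × ℝ → ℝ} (h0 : ∀ z ∈ Γ, z ∉ D → F z = 0)
    {z : ℝ × ℝ} (he : Γ ∩ D = {z}) :
    ∑' y : {y : ℝ × ℝ // y ∈ Γ ∧ y.1 < 0}, F y = if z.1 < 0 then F z else 0 := by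
  have hz : z ∈ Γ := (he.symm ▸ mem_singleton z : z ∈ Γ ∩ D).1
  have hzero : ∀ y : {y : ℝ × ℝ // y ∈ Γ ∧ y.1 < 0}, (y : ℝ × ℝ) ≠ z → F y = 0 := fun y hy =>
    h0 y y.2.1 fun hD => hy ((Set.ext_iff.1 he y).1 ⟨y.2.1, hD⟩)
  split_ifs with hz1
  · exact tsum_eq_single (⟨z, hz, hz1⟩ : {y : ℝ × ℝ // y ∈ Γ ∧ y.1 < 0})
      fun y hy => hzero y fun h => hy (Subtype.ext h)
  · exact (tsum_congr fun y => hzero y fun h => hz1 (h ▸ y.2.2)).trans tsum_zero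

theorem abs_tsum_window_le {Γ D : Set (ℝ × ℝ)} {F : ℝ × ℝ → ℝ} {K : ℝ} (hK : 0 ≤ K)
    (h0 : ∀ z ∈ Γ, z ∉ D → F z = 0) (hF : ∀ z ∈ Γ, |F z| ≤ K) (hfin : (Γ ∩ D).Finite) :
    |∑' y : {y : ℝ × ℝ // y ∈ Γ ∧ y.1 < 0}, F y| ≤ K * (Γ ∩ D).ncard := by
  classical
  have hfin' : {y : {y : ℝ × ℝ // y ∈ Γ ∧ y.1 < 0} | (y : ℝ × ℝ) ∈ Γ ∩ D}.Finite :=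
    hfin.preimage Subtype.val_injective.injOn
  rw [tsum_eq_sum (s := hfin'.toFinset)]
  · refine (Finset.abs_sum_le_sum_abs _ _).trans
      ((Finset.sum_le_card_nsmul _ _ K fun (y : {y : ℝ × ℝ // y ∈ Γ ∧ y.1 < 0}) _ =>
        hF y.1 y.2.1).trans ?_)
    rw [nsmul_eq_mul, mul_comm]
    refine mul_le_mul_of_nonneg_left ?_ hK
    rw [← ncard_eq_toFinset_card _ hfin']
    exact_mod_cast ncard_le_ncard_of_injOn Subtype.val (fun y hy => hy)
      Subtype.val_injective.injOn hfin
  · intro y hy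
    exact h0 y y.2.1 fun hD => hy (by simpa using ⟨y.2.1, hD⟩)

/-! ### Moments of the Poisson law -/

theorem hasSum_poisson_mul_id (r : NNReal) :
    HasSum (fun n : ℕ => Real.exp (-r) * (r : ℝ) ^ n / (n.factorial : ℝ) * n) r := by
  rw [← hasSum_nat_add_iff' 1]
  have h := (hasSum_one_poissonMeasure r).mul_right (r : ℝ)
  simp only [Finset.range_one, Finset.sum_singleton, Nat.cast_zero, mul_zero, sub_zero]
  rw [one_mul] at h
  refine h.congr_fun fun n => ?_
  rw [Nat.factorial_succ]
  push_cast
  have : (n.factorial : ℝ) ≠ 0 := by positivity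
  field_simp
  ring

theorem integrable_natCast_poisson (r : NNReal) :
    Integrable (fun n : ℕ => (n : ℝ)) (poissonMeasure r) := by
  rw [integrable_poissonMeasure_iff]
  simpa using (hasSum_poisson_mul_id r).summable

theorem integral_natCast_poisson (r : NNReal) : ∫ n : ℕ, (n : ℝ) ∂(poissonMeasure r) = r := by
  rw [integral_poissonMeasure]
  simpa using (hasSum_poisson_mul_id r).tsum_eq

/-- The mean of the number of points, restricted to at least two points. -/
theorem integral_two_le_poisson (r : NNReal) :
    ∫ n : ℕ, (if 2 ≤ n then (n : ℝ) else 0) ∂(poissonMeasure r) ≤ (r : ℝ) ^ 2 := by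
  -- n·1_{n ≥ 2} = n - 1_{n = 1}, so the mean is r - r·e^{-r} = r(1 - e^{-r}) ≤ r².
  have e : (fun n : ℕ => if 2 ≤ n then (n : ℝ) else 0) =
      fun n : ℕ => (n : ℝ) - ({1} : Set ℕ).indicator (fun _ => (1 : ℝ)) n := by
    funext n
    rcases n with _ | _ | n
    · simp
    · simp
    · simp
  rw [e, integral_sub (integrable_natCast_poisson r)
    ((integrable_const _).indicator (measurableSet_singleton _)), integral_natCast_poisson,
    integral_indicator_const _ (measurableSet_singleton _), poissonMeasure_real_singleton]
  have h := Real.add_one_le_exp (-(r : ℝ))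
  have := mul_le_mul_of_nonneg_left h r.2
  simp only [pow_one, Nat.factorial_one, Nat.cast_one, div_one, smul_eq_mul, mul_one]
  nlinarith [this]

/-! ### Sums over a Poisson process -/

namespace IsPoissonProcess

variable {Ω S : Type*} [MeasurableSpace Ω] [MeasurableSpace S]
  {Γ : Ω → Set S} {ν : Measure S} {P : Measure Ω} {D : Set S}

/-- The Poisson weights on the natural numbers already sum to 1, which leaves no probability for the
value `⊤`. -/
theorem ae_finite [IsProbabilityMeasure P] (h : IsPoissonProcess Γ ν P) (hD : MeasurableSet D)
    (hν : ν D ≠ ⊤) : ∀ᵐ ω ∂P, (Γ ω ∩ D).Finite := by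
  have hm : ∀ k : ℕ, MeasurableSet {ω | (Γ ω ∩ D).encard = k} := fun k =>
    h.measurable_count D hD (measurableSet_singleton (k : ℕ∞))
  have h1 : P (⋃ k : ℕ, {ω | (Γ ω ∩ D).encard = k}) = 1 := by
    rw [measure_iUnion _ hm]
    · simp_rw [h.law_count D hD hν]
      rw [← measure_iUnion _ fun k : ℕ => measurableSet_singleton k, iUnion_of_singleton,
        measure_univ]
      intro i j hij
      simpa using hij
    · intro i j hij
      refine Set.disjoint_left.2 fun ω hi hj => hij ?_
      have : (i : ℕ∞) = j := (hi : _ = _).symm.trans hj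
      exact_mod_cast this
  have h2 : ∀ᵐ ω ∂P, ω ∈ ⋃ k : ℕ, {ω | (Γ ω ∩ D).encard = k} := by
    rw [← prob_compl_eq_zero_iff (MeasurableSet.iUnion hm)] at h1
    exact h1
  filter_upwards [h2] with ω hω
  obtain ⟨k, hk⟩ := mem_iUnion.1 hω
  exact finite_of_encard_eq_coe hk

theorem measurable_ncard (h : IsPoissonProcess Γ ν P) (hD : MeasurableSet D) :
    Measurable fun ω => (Γ ω ∩ D).ncard :=
  (measurable_of_countable ENat.toNat).comp (h.measurable_count D hD)

theorem map_ncard [IsProbabilityMeasure P] (h : IsPoissonProcess Γ ν P) (hD : MeasurableSet D)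
    (hν : ν D ≠ ⊤) : P.map (fun ω => (Γ ω ∩ D).ncard) = poissonMeasure (ν D).toNNReal := by
  refine Measure.ext_of_singleton fun k => ?_
  rw [Measure.map_apply (h.measurable_ncard hD) (measurableSet_singleton k),
    ← h.law_count D hD hν k]
  refine measure_congr ?_
  filter_upwards [h.ae_finite hD hν] with ω hω
  refine propext ?_
  change (Γ ω ∩ D).ncard = k ↔ (Γ ω ∩ D).encard = k
  rw [← hω.cast_ncard_eq]
  exact_mod_cast Iff.rfl

theorem integrable_ncard [IsProbabilityMeasure P] (h : IsPoissonProcess Γ ν P)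
    (hD : MeasurableSet D) (hν : ν D ≠ ⊤) :
    Integrable (fun ω => ((Γ ω ∩ D).ncard : ℝ)) P := by
  have := integrable_natCast_poisson (ν D).toNNReal
  rw [← h.map_ncard hD hν] at this
  exact this.comp_measurable (h.measurable_ncard hD)

theorem integral_two_le_ncard [IsProbabilityMeasure P] (h : IsPoissonProcess Γ ν P)
    (hD : MeasurableSet D) (hν : ν D ≠ ⊤) :
    ∫ ω, (if 2 ≤ (Γ ω ∩ D).ncard then ((Γ ω ∩ D).ncard : ℝ) else 0) ∂P ≤ (ν D).toReal ^ 2 := by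
  have h1 := integral_two_le_poisson (ν D).toNNReal
  rw [← h.map_ncard hD hν, integral_map (h.measurable_ncard hD).aemeasurable
    (measurable_of_countable _).aestronglyMeasurable] at h1
  exact h1

theorem lintegral_encard [IsProbabilityMeasure P] (h : IsPoissonProcess Γ ν P)
    (hD : MeasurableSet D) (hν : ν D ≠ ⊤) :
    ∫⁻ ω, ((Γ ω ∩ D).encard : ENNReal) ∂P = ν D := by
  have h1 : ∫ ω, ((Γ ω ∩ D).ncard : ℝ) ∂P = (ν D).toReal := by
    have := integral_natCast_poisson (ν D).toNNReal
    rwa [← h.map_ncard hD hν, integral_map (h.measurable_ncard hD).aemeasurable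
      (measurable_of_countable _).aestronglyMeasurable] at this
  rw [← ENNReal.ofReal_toReal hν, ← h1, ofReal_integral_eq_lintegral_ofReal
    (h.integrable_ncard hD hν) (Eventually.of_forall fun ω => Nat.cast_nonneg _)]
  refine lintegral_congr_ae ?_
  filter_upwards [h.ae_finite hD hν] with ω hω
  rw [← hω.cast_ncard_eq]
  simp

variable [MeasurableSingletonClass S]

theorem count_restrict_apply (h : IsPoissonProcess Γ ν P) (hD : MeasurableSet D) (ω : Ω)
    {A : Set S} (hA : MeasurableSet A) :
    Measure.count.restrict (Γ ω ∩ D) A = ((Γ ω ∩ (A ∩ D)).encard : ENNReal) := by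
  rw [Measure.restrict_apply hA, Measure.count_apply
    (hA.inter ((h.countable ω).measurableSet.inter hD))]
  congr 2
  ext z; simp only [mem_inter_iff]; tauto

theorem measurable_count_restrict (h : IsPoissonProcess Γ ν P) (hD : MeasurableSet D) :
    Measurable fun ω => (Measure.count.restrict (Γ ω ∩ D) : Measure S) := by
  refine Measure.measurable_of_measurable_coe _ fun A hA => ?_
  simp_rw [h.count_restrict_apply hD _ hA]
  exact (measurable_of_countable (fun n : ℕ∞ => (n : ENNReal))).comp
    (h.measurable_count _ (hA.inter hD))

/-- Seen as a random measure, the process has mean measure ν on `D`, since the mean number of points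
in each subset is its intensity. Campbell's formula is integration against this identity. -/
theorem bind_count_restrict [IsProbabilityMeasure P] (h : IsPoissonProcess Γ ν P)
    (hD : MeasurableSet D) (hν : ν D ≠ ⊤) :
    P.bind (fun ω => (Measure.count.restrict (Γ ω ∩ D) : Measure S)) = ν.restrict D := by
  refine Measure.ext fun A hA => ?_
  rw [Measure.bind_apply hA (h.measurable_count_restrict hD).aemeasurable,
    Measure.restrict_apply hA]
  simp_rw [h.count_restrict_apply hD _ hA]
  exact h.lintegral_encard (hA.inter hD)
    (ne_top_of_le_ne_top hν (measure_mono inter_subset_right))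

theorem isFiniteMeasure_count_restrict {s : Set S} (hs : s.Finite) :
    IsFiniteMeasure (Measure.count.restrict s : Measure S) :=
  ⟨by rw [Measure.restrict_apply_univ]; exact Measure.count_apply_lt_top.2 hs⟩

theorem lintegral_lintegral_count [IsProbabilityMeasure P] (h : IsPoissonProcess Γ ν P)
    (hD : MeasurableSet D) (hν : ν D ≠ ⊤) {g : S → ENNReal} (hg : Measurable g) :
    ∫⁻ ω, ∫⁻ z in Γ ω ∩ D, g z ∂Measure.count ∂P = ∫⁻ z in D, g z ∂ν := by
  rw [← h.bind_count_restrict hD hν, Measure.lintegral_bind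
    (h.measurable_count_restrict hD).aemeasurable hg.aemeasurable]

/-- Campbell's formula for a bounded function. -/
theorem integral_integral_count [IsProbabilityMeasure P] (h : IsPoissonProcess Γ ν P)
    (hD : MeasurableSet D) (hν : ν D ≠ ⊤) {G : S → ℝ} (hG : Measurable G) {K : ℝ}
    (hK : ∀ z, |G z| ≤ K) :
    Integrable (fun ω => ∫ z in Γ ω ∩ D, G z ∂Measure.count) P ∧
      ∫ ω, ∫ z in Γ ω ∩ D, G z ∂Measure.count ∂P = ∫ z in D, G z ∂ν := by
  have : IsFiniteMeasure (ν.restrict D) := ⟨by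
    rw [Measure.restrict_apply_univ]; exact lt_top_iff_ne_top.2 hν⟩
  have hint : ∀ (ρ : Measure S) [IsFiniteMeasure ρ], Integrable G ρ := fun ρ _ =>
    Integrable.of_bound hG.aestronglyMeasurable K (Eventually.of_forall hK)
  have hp : Measurable fun z => ENNReal.ofReal (G z) := hG.ennreal_ofReal
  have hn : Measurable fun z => ENNReal.ofReal (-G z) := hG.neg.ennreal_ofReal
  have hae : (fun ω => ∫ z in Γ ω ∩ D, G z ∂Measure.count) =ᵐ[P] fun ω =>
      (∫⁻ z in Γ ω ∩ D, ENNReal.ofReal (G z) ∂Measure.count).toReal -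
      (∫⁻ z in Γ ω ∩ D, ENNReal.ofReal (-G z) ∂Measure.count).toReal := by
    filter_upwards [h.ae_finite hD hν] with ω hω
    have := isFiniteMeasure_count_restrict hω
    exact integral_eq_lintegral_pos_part_sub_lintegral_neg_part (hint _)
  have key : ∀ g : S → ENNReal, Measurable g → (∫⁻ z in D, g z ∂ν) ≠ ⊤ →
      Integrable (fun ω => (∫⁻ z in Γ ω ∩ D, g z ∂Measure.count).toReal) P ∧
      ∫ ω, (∫⁻ z in Γ ω ∩ D, g z ∂Measure.count).toReal ∂P =
        (∫⁻ z in D, g z ∂ν).toReal := by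
    intro g hg htop
    have hm : Measurable fun ω => ∫⁻ z in Γ ω ∩ D, g z ∂Measure.count :=
      (Measure.measurable_lintegral hg).comp (h.measurable_count_restrict hD)
    rw [← h.lintegral_lintegral_count hD hν hg] at htop ⊢
    exact ⟨integrable_toReal_of_lintegral_ne_top hm.aemeasurable htop,
      integral_toReal hm.aemeasurable (ae_lt_top hm htop)⟩
  have h1 := key _ hp (hint (ν.restrict D)).lintegral_lt_top.ne
  have h2 := key _ hn (hint (ν.restrict D)).neg.lintegral_lt_top.ne
  refine ⟨(h1.1.sub h2.1).congr hae.symm, ?_⟩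
  rw [integral_congr_ae hae, integral_sub h1.1 h2.1, h1.2, h2.2,
    integral_eq_lintegral_pos_part_sub_lintegral_neg_part (hint _)]

/-- A functional of the process that is determined by a single point and grows at most linearly
in the number of points has, up to a quadratic error, the mean given by Campbell's formula. -/
theorem abs_integral_sub_le [IsProbabilityMeasure P] (h : IsPoissonProcess Γ ν P)
    (hD : MeasurableSet D) (hν : ν D ≠ ⊤) {G : S → ℝ} (hG : Measurable G) {K : ℝ} (hK0 : 0 ≤ K)
    (hK : ∀ z, |G z| ≤ K) {Y : Ω → ℝ} (hY : AEStronglyMeasurable Y P)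
    (hb : ∀ᵐ ω ∂P, (Γ ω ∩ D).Finite → |Y ω| ≤ K * (Γ ω ∩ D).ncard)
    (hs : ∀ᵐ ω ∂P, ∀ z, Γ ω ∩ D = {z} → Y ω = G z) :
    Integrable Y P ∧ |∫ ω, Y ω ∂P - ∫ z in D, G z ∂ν| ≤ 2 * K * (ν D).toReal ^ 2 := by
  have hfin := h.ae_finite hD hν
  have hN := h.integrable_ncard hD hν
  have hYi : Integrable Y P := (hN.const_mul K).mono' hY <| by
    filter_upwards [hb, hfin] with ω h1 h2 using h1 h2
  obtain ⟨hCi, hC⟩ := h.integral_integral_count hD hν hG hK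
  refine ⟨hYi, ?_⟩
  rw [← hC, ← integral_sub hYi hCi]
  have hNi : Integrable
      (fun ω => if 2 ≤ (Γ ω ∩ D).ncard then ((Γ ω ∩ D).ncard : ℝ) else 0) P := by
    refine hN.mono' ?_ (Eventually.of_forall fun ω => ?_)
    · exact ((measurable_of_countable (fun n : ℕ => if 2 ≤ n then (n : ℝ) else 0)).comp
        (h.measurable_ncard hD)).aestronglyMeasurable
    · split_ifs <;> simp
  calc |∫ ω, (Y ω - ∫ z in Γ ω ∩ D, G z ∂Measure.count) ∂P|
      ≤ ∫ ω, 2 * K * (if 2 ≤ (Γ ω ∩ D).ncard then ((Γ ω ∩ D).ncard : ℝ) else 0) ∂P := by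
        refine norm_integral_le_of_norm_le (f := fun ω => Y ω - ∫ z in Γ ω ∩ D, G z ∂Measure.count)
          (hNi.const_mul _) ?_
        filter_upwards [hb, hs, hfin] with ω h1 h2 h3
        -- With two or more points both quantities are at most K times their number. With none both
        -- vanish, and with one they agree by `hs`.
        split_ifs with h4
        · have h5 : |∫ z in Γ ω ∩ D, G z ∂Measure.count| ≤ K * (Γ ω ∩ D).ncard := by
            have := isFiniteMeasure_count_restrict h3
            refine (norm_integral_le_of_norm_le_const (f := G)
              (μ := (Measure.count.restrict (Γ ω ∩ D) : Measure S))
              (Eventually.of_forall hK)).trans_eq ?_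
            rw [measureReal_restrict_apply_univ, Measure.real,
              Measure.count_apply h3.measurableSet, ← h3.cast_ncard_eq]
            simp
          refine (abs_sub _ _).trans ?_
          linarith [h1 h3]
        · have h6 : (Γ ω ∩ D).ncard = 0 ∨ (Γ ω ∩ D).ncard = 1 := by omega
          rcases h6 with h6 | h6
          · have h7 := h1 h3
            rw [h6, Nat.cast_zero, mul_zero] at h7
            rw [(ncard_eq_zero h3).1 h6, abs_nonpos_iff.1 h7]
            simp
          · obtain ⟨z, hz⟩ := ncard_eq_one.1 h6
            rw [h2 z hz, hz]
            simp [Measure.restrict_singleton]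
    _ ≤ 2 * K * (ν D).toReal ^ 2 := by
        rw [integral_const_mul]
        exact mul_le_mul_of_nonneg_left (h.integral_two_le_ncard hD hν) (by positivity)

end IsPoissonProcess

/-! ### Intensity of the gas, hit sets and collision rates -/

/-- `p` is a density of a gas with velocities in the range `vmin < |v| < vmax`. -/
structure IsGasDensity (vmin vmax : ℝ) (p : ℝ → ℝ) : Prop where
  measurable : Measurable p
  nonneg : ∀ v, 0 ≤ p v
  integrable : Integrable p
  cutoff : ∀ v, |v| ≤ vmin ∨ vmax ≤ |v| → p v = 0

theorem IsVelocityDensity.isGasDensity {vmin vmax : ℝ} {f p : ℝ → ℝ}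
    (hf : IsVelocityDensity vmin vmax f) {n : ℝ} (hn : 0 < n) (hp : ∀ v, p v = n * f v) :
    IsGasDensity vmin vmax p := by
  obtain rfl : p = fun v => n * f v := funext hp
  exact ⟨hf.measurable.const_mul n, fun v => mul_nonneg hn.le (hf.nonneg v),
    hf.integrable.const_mul n, fun v hv => by simp [hf.cutoff v hv]⟩

theorem IsPoissonProcess.ae_inter_eq_empty {Ω S : Type*} [MeasurableSpace Ω] [MeasurableSpace S]
    {Γ : Ω → Set S} {ν : Measure S} {P : Measure Ω} [IsProbabilityMeasure P] {D : Set S}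
    (h : IsPoissonProcess Γ ν P) (hD : MeasurableSet D) (hν : ν D = 0) :
    ∀ᵐ ω ∂P, Γ ω ∩ D = ∅ := by
  have h1 := h.law_count D hD (by simp [hν]) 0
  have hm : MeasurableSet {ω | (Γ ω ∩ D).encard = (0 : ℕ)} :=
    h.measurable_count D hD (measurableSet_singleton ((0 : ℕ) : ℕ∞))
  rw [hν, poissonMeasure_singleton] at h1
  simp only [ENNReal.toNNReal_zero, NNReal.coe_zero, neg_zero, Real.exp_zero, pow_zero, mul_one,
    Nat.factorial_zero, Nat.cast_one, div_one, ENNReal.ofReal_one] at h1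
  rw [← prob_compl_eq_zero_iff hm] at h1
  filter_upwards [show ∀ᵐ ω ∂P, ω ∈ {ω | (Γ ω ∩ D).encard = (0 : ℕ)} from h1] with ω hω
  exact encard_eq_zero.1 (by simpa using hω)

section Intensity

variable {vmin vmax Vbar : ℝ} {pL pR : ℝ → ℝ}

theorem measurable_gas (hL : IsGasDensity vmin vmax pL) (hR : IsGasDensity vmin vmax pR) :
    Measurable fun z : ℝ × ℝ => if z.1 < 0 then pL z.2 else pR z.2 :=
  Measurable.ite (measurableSet_lt measurable_fst measurable_const)
    (hL.measurable.comp measurable_snd) (hR.measurable.comp measurable_snd)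

/-- The exceptional sets are null for the intensity: a vertical line in the phase plane, and the
velocities where both densities vanish. A Poisson process almost surely has no point in a null set.
-/
theorem ae_gas (hL : IsGasDensity vmin vmax pL) (hR : IsGasDensity vmin vmax pR)
    {Ω : Type*} [MeasurableSpace Ω] {P : Measure Ω} [IsProbabilityMeasure P]
    {Γ : Ω → Set (ℝ × ℝ)} (h : IsPoissonProcess Γ (gasIntensity pL pR) P) :
    ∀ᵐ ω ∂P, ∀ z ∈ Γ ω, z.1 ≠ 0 ∧ vmin < |z.2| ∧ |z.2| < vmax := by
  set B₁ : Set (ℝ × ℝ) := {0} ×ˢ univ with hB₁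
  set B₂ : Set (ℝ × ℝ) := {z | |z.2| ≤ vmin} ∪ {z | vmax ≤ |z.2|} with hB₂
  have hm₁ : MeasurableSet B₁ := (measurableSet_singleton 0).prod MeasurableSet.univ
  have hm₂ : MeasurableSet B₂ :=
    (measurableSet_le measurable_snd.abs measurable_const).union
      (measurableSet_le measurable_const measurable_snd.abs)
  have h₁ : gasIntensity pL pR B₁ = 0 := by
    refine withDensity_absolutelyContinuous _ _ ?_
    rw [hB₁, Measure.volume_eq_prod, Measure.prod_prod]
    simp
  have h₂ : gasIntensity pL pR B₂ = 0 := by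
    rw [gasIntensity, withDensity_apply _ hm₂,
      setLIntegral_congr_fun (g := fun _ => 0) hm₂ (fun z hz => ?_), lintegral_zero]
    simp [hL.cutoff z.2 hz, hR.cutoff z.2 hz]
  filter_upwards [h.ae_inter_eq_empty hm₁ h₁, h.ae_inter_eq_empty hm₂ h₂] with ω hω₁ hω₂ z hz
  refine ⟨fun h0 => eq_empty_iff_forall_notMem.1 hω₁ z ⟨hz, h0, mem_univ _⟩, ?_, ?_⟩
  · by_contra hc
    exact eq_empty_iff_forall_notMem.1 hω₂ z ⟨hz, Or.inl (not_lt.1 hc)⟩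
  · by_contra hc
    exact eq_empty_iff_forall_notMem.1 hω₂ z ⟨hz, Or.inr (not_lt.1 hc)⟩

theorem measurableSet_window (t : ℝ) : MeasurableSet (window vmax Vbar t) :=
  measurableSet_Icc.prod MeasurableSet.univ

/-- The density is dominated by pL(v) + pR(v), which is independent of x, so the mass is at most the
length of the position interval times the total density. This makes the mean number of relevant
atoms O(t). -/
theorem gasIntensity_window_le (hL : IsGasDensity vmin vmax pL)
    (hR : IsGasDensity vmin vmax pR) (t : ℝ) :
    gasIntensity pL pR (window vmax Vbar t) ≤
      ENNReal.ofReal (2 * (vmax + Vbar) * t) * ENNReal.ofReal ((∫ v, pL v) + ∫ v, pR v) := by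
  have hmeas : Measurable fun v => ENNReal.ofReal (pL v + pR v) :=
    (hL.measurable.add hR.measurable).ennreal_ofReal
  rw [gasIntensity, withDensity_apply _ (measurableSet_window t)]
  calc ∫⁻ z in window vmax Vbar t, ENNReal.ofReal (if z.1 < 0 then pL z.2 else pR z.2)
      ≤ ∫⁻ z in window vmax Vbar t, ENNReal.ofReal (pL z.2 + pR z.2) := by
        refine lintegral_mono fun z => ENNReal.ofReal_le_ofReal ?_
        split_ifs
        · linarith [hR.nonneg z.2]
        · linarith [hL.nonneg z.2]
    _ = _ := by
        rw [window, Measure.volume_eq_prod, ← Measure.prod_restrict, Measure.restrict_univ,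
          lintegral_prod (fun z => ENNReal.ofReal (pL z.2 + pR z.2))
            (hmeas.comp measurable_snd).aemeasurable]
        simp only [lintegral_const, Measure.restrict_apply_univ, Real.volume_Icc]
        have e : ENNReal.ofReal (∫ v, (pL v + pR v)) = ∫⁻ v, ENNReal.ofReal (pL v + pR v) :=
          ofReal_integral_eq_lintegral_ofReal (hL.integrable.add hR.integrable)
            (Eventually.of_forall fun v => add_nonneg (hL.nonneg v) (hR.nonneg v))
        rw [mul_comm, ← integral_add hL.integrable hR.integrable, e]
        congr 2
        ring

/-- Fubini with x integrated first: the slice of `E` at velocity v contributes its length. The bound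
`R` serves only integrability. -/
theorem integral_indicator_snd {E : Set (ℝ × ℝ)} (hE : MeasurableSet E) {R : ℝ}
    (hER : E ⊆ Icc (-R) R ×ˢ univ) {h ℓ : ℝ → ℝ} (hh : Integrable h)
    (hℓ : ∀ v, volume.real {x | (x, v) ∈ E} = ℓ v) :
    Integrable (E.indicator fun z => h z.2) ∧
      ∫ z, E.indicator (fun z => h z.2) z = ∫ v, ℓ v * h v := by
  have h1 : Integrable (fun z : ℝ × ℝ => (Icc (-R) R).indicator (fun _ => (1 : ℝ)) z.1 * h z.2) :=
    Integrable.mul_prod ((integrable_indicator_iff measurableSet_Icc).2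
      (integrableOn_const (by simp) (by simp))) hh
  have h2 : Integrable (E.indicator fun z => h z.2) := by
    refine (h1.indicator hE).congr (Eventually.of_forall fun z => ?_)
    by_cases hz : z ∈ E
    · simp only [indicator_of_mem hz, indicator_of_mem (hER hz).1, one_mul]
    · simp only [indicator_of_notMem hz]
  refine ⟨h2, ?_⟩
  rw [Measure.volume_eq_prod] at h2 ⊢
  rw [integral_prod_symm _ h2]
  refine integral_congr_ae (Eventually.of_forall fun v => ?_)
  have hm : MeasurableSet {x | (x, v) ∈ E} := hE.preimage measurable_prodMk_right
  have e : (fun x => E.indicator (fun z => h z.2) (x, v)) =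
      {x | (x, v) ∈ E}.indicator fun _ => h v := rfl
  dsimp only
  rw [e, integral_indicator_const _ hm, hℓ, smul_eq_mul]

/-- The atoms that start to the left and reach a piston of constant velocity `u`. -/
def hitL (vmin vmax u t : ℝ) : Set (ℝ × ℝ) :=
  {z | z.1 < 0 ∧ z.2 ∈ Ioo vmin vmax ∧ -((z.2 - u) * t) ≤ z.1}

/-- The atoms that start to the right and reach a piston of constant velocity `u`. -/
def hitR (vmin vmax u t : ℝ) : Set (ℝ × ℝ) :=
  {z | 0 < z.1 ∧ z.2 ∈ Ioo (-vmax) (-vmin) ∧ z.1 ≤ (u - z.2) * t}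

theorem measurableSet_hitL (u t : ℝ) : MeasurableSet (hitL vmin vmax u t) :=
  (measurableSet_lt measurable_fst measurable_const).inter
    ((measurable_snd measurableSet_Ioo).inter
      (measurableSet_le (((measurable_snd.sub_const u).mul_const t).neg) measurable_fst))

theorem measurableSet_hitR (u t : ℝ) : MeasurableSet (hitR vmin vmax u t) :=
  (measurableSet_lt measurable_const measurable_fst).inter
    ((measurable_snd measurableSet_Ioo).inter
      (measurableSet_le measurable_fst ((measurable_snd.const_sub u).mul_const t)))

/-- The function of a single atom that is `gL v` or `gR v` if it reaches the piston. -/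
noncomputable def hitValue (vmin vmax u t : ℝ) (gL gR : ℝ → ℝ) (z : ℝ × ℝ) : ℝ :=
  (hitL vmin vmax u t).indicator (fun z => gL z.2) z +
    (hitR vmin vmax u t).indicator (fun z => gR z.2) z

theorem hitValue_of_hitL {u t : ℝ} {gL gR : ℝ → ℝ} {z : ℝ × ℝ} (hz : z ∈ hitL vmin vmax u t) :
    hitValue vmin vmax u t gL gR z = gL z.2 := by
  have : z ∉ hitR vmin vmax u t := fun h => by linarith [hz.1, h.1]
  simp [hitValue, hz, this]

theorem hitValue_of_hitR {u t : ℝ} {gL gR : ℝ → ℝ} {z : ℝ × ℝ} (hz : z ∈ hitR vmin vmax u t) :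
    hitValue vmin vmax u t gL gR z = gR z.2 := by
  have : z ∉ hitL vmin vmax u t := fun h => by linarith [hz.1, h.1]
  simp [hitValue, hz, this]

theorem hitValue_of_not_hit {u t : ℝ} {gL gR : ℝ → ℝ} {z : ℝ × ℝ}
    (hz : ¬ Hit vmin vmax u t z) : hitValue vmin vmax u t gL gR z = 0 := by
  have h1 : z ∉ hitL vmin vmax u t := fun h => hz (Or.inl h)
  have h2 : z ∉ hitR vmin vmax u t := fun h => hz (Or.inr h)
  simp [hitValue, h1, h2]

theorem measurable_hitValue {u t : ℝ} {gL gR : ℝ → ℝ} (hgL : Measurable gL)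
    (hgR : Measurable gR) : Measurable (hitValue vmin vmax u t gL gR) :=
  ((hgL.comp measurable_snd).indicator (measurableSet_hitL u t)).add
    ((hgR.comp measurable_snd).indicator (measurableSet_hitR u t))

theorem abs_hitValue_le {u t K : ℝ} {gL gR : ℝ → ℝ} (hK : 0 ≤ K)
    (hgL : ∀ v ∈ Ioo vmin vmax, |gL v| ≤ K) (hgR : ∀ v ∈ Ioo (-vmax) (-vmin), |gR v| ≤ K)
    (z : ℝ × ℝ) : |hitValue vmin vmax u t gL gR z| ≤ K := by
  by_cases hz : Hit vmin vmax u t z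
  · rcases hz with hz | hz
    · rw [hitValue_of_hitL hz]; exact hgL _ hz.2.1
    · rw [hitValue_of_hitR hz]; exact hgR _ hz.2.1
  · rw [hitValue_of_not_hit hz, abs_zero]; exact hK

/-- The rate at which collisions with a piston of velocity `u` change a quantity by `gL v` or
`gR v`. -/
noncomputable def rate (vmin vmax : ℝ) (pL pR : ℝ → ℝ) (u : ℝ) (gL gR : ℝ → ℝ) : ℝ :=
  (∫ v in vmin..vmax, (v - u) * gL v * pL v) +
    ∫ v in (-vmax)..(-vmin), (u - v) * gR v * pR v

theorem hit_subset_window {u t : ℝ} (ht : 0 ≤ t) (hu : |u| ≤ Vbar) {z : ℝ × ℝ}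
    (hz : Hit vmin vmax u t z) : z ∈ window vmax Vbar t := by
  rw [abs_le] at hu
  refine ⟨?_, mem_univ _⟩
  rcases hz with ⟨h1, h2, h3⟩ | ⟨h1, h2, h3⟩
  · have := mul_le_mul_of_nonneg_right (show z.2 - u ≤ vmax + Vbar by linarith [h2.2]) ht
    constructor <;> linarith
  · have := mul_le_mul_of_nonneg_right (show u - z.2 ≤ vmax + Vbar by linarith [h2.1]) ht
    constructor <;> linarith

theorem integrable_indicator_mul (hL : IsGasDensity vmin vmax pL) {g : ℝ → ℝ}
    (hg : Measurable g) {K : ℝ} {I : Set ℝ} (hI : MeasurableSet I) (hK : ∀ v ∈ I, |g v| ≤ K) :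
    Integrable (I.indicator fun v => g v * pL v) := by
  refine (hL.integrable.const_mul |K|).mono'
    ((hg.mul hL.measurable).indicator hI).aestronglyMeasurable (Eventually.of_forall fun v => ?_)
  by_cases hv : v ∈ I
  · rw [indicator_of_mem hv, Real.norm_eq_abs, abs_mul, abs_of_nonneg (hL.nonneg v)]
    exact mul_le_mul_of_nonneg_right ((hK v hv).trans (le_abs_self _)) (hL.nonneg v)
  · rw [indicator_of_notMem hv, norm_zero]
    exact mul_nonneg (abs_nonneg _) (hL.nonneg v)

/-- The atoms of velocity v that reach a piston of constant velocity u start in an interval of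
length |v - u|t, so Campbell's integral is exactly linear in t. -/
theorem integral_hitValue (hL : IsGasDensity vmin vmax pL) (hR : IsGasDensity vmin vmax pR)
    (hv : vmin < vmax) (hV : Vbar < vmin) {u t K : ℝ} (ht : 0 ≤ t) (hu : |u| ≤ Vbar)
    {gL gR : ℝ → ℝ} (hgL : Measurable gL) (hgR : Measurable gR)
    (hKL : ∀ v ∈ Ioo vmin vmax, |gL v| ≤ K) (hKR : ∀ v ∈ Ioo (-vmax) (-vmin), |gR v| ≤ K) :
    ∫ z in window vmax Vbar t, hitValue vmin vmax u t gL gR z ∂gasIntensity pL pR =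
      t * rate vmin vmax pL pR u gL gR := by
  have hu' := abs_le.1 hu
  rw [setIntegral_eq_integral_of_forall_compl_eq_zero (fun z hz => hitValue_of_not_hit
    fun hh => hz (hit_subset_window ht hu hh)), gasIntensity,
    integral_withDensity_eq_integral_toReal_smul (measurable_gas hL hR).ennreal_ofReal
      (Eventually.of_forall fun z => ENNReal.ofReal_lt_top)]
  have e : (fun z : ℝ × ℝ => (ENNReal.ofReal (if z.1 < 0 then pL z.2 else pR z.2)).toReal •
      hitValue vmin vmax u t gL gR z) = fun z =>
      (hitL vmin vmax u t).indicator
        (fun z => (Ioo vmin vmax).indicator (fun v => gL v * pL v) z.2) z +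
      (hitR vmin vmax u t).indicator
        (fun z => (Ioo (-vmax) (-vmin)).indicator (fun v => gR v * pR v) z.2) z := by
    funext z
    have hpos : 0 ≤ if z.1 < 0 then pL z.2 else pR z.2 := by
      split_ifs
      exacts [hL.nonneg _, hR.nonneg _]
    rw [ENNReal.toReal_ofReal hpos, smul_eq_mul, hitValue, mul_add]
    congr 1
    · by_cases hz : z ∈ hitL vmin vmax u t
      · rw [indicator_of_mem hz, indicator_of_mem hz, indicator_of_mem hz.2.1, if_pos hz.1,
          mul_comm]
      · rw [indicator_of_notMem hz, indicator_of_notMem hz, mul_zero]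
    · by_cases hz : z ∈ hitR vmin vmax u t
      · rw [indicator_of_mem hz, indicator_of_mem hz, indicator_of_mem hz.2.1,
          if_neg (not_lt.2 hz.1.le), mul_comm]
      · rw [indicator_of_notMem hz, indicator_of_notMem hz, mul_zero]
  obtain ⟨iL, eL⟩ := integral_indicator_snd (measurableSet_hitL (vmin := vmin) (vmax := vmax) u t)
    (R := (vmax + Vbar) * t) (fun z hz => hit_subset_window ht hu (Or.inl hz))
    (integrable_indicator_mul hL hgL measurableSet_Ioo hKL)
    (ℓ := (Ioo vmin vmax).indicator fun v => (v - u) * t) (fun v => by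
      by_cases h : v ∈ Ioo vmin vmax
      · have : {x | (x, v) ∈ hitL vmin vmax u t} = Ico (-((v - u) * t)) 0 := by
          ext x; simp only [hitL, mem_ofPred_eq, mem_Ico]; tauto
        rw [this, indicator_of_mem h, Measure.real, Real.volume_Ico, ENNReal.toReal_ofReal] <;>
        nlinarith [mul_nonneg (show 0 ≤ v - u by linarith [h.1]) ht]
      · have : {x | (x, v) ∈ hitL vmin vmax u t} = ∅ := by
          ext x; simp only [hitL, mem_ofPred_eq, mem_empty_iff_false]; tauto
        rw [this, indicator_of_notMem h]; simp)
  obtain ⟨iR, eR⟩ := integral_indicator_snd (measurableSet_hitR (vmin := vmin) (vmax := vmax) u t)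
    (R := (vmax + Vbar) * t) (fun z hz => hit_subset_window ht hu (Or.inr hz))
    (integrable_indicator_mul hR hgR measurableSet_Ioo hKR)
    (ℓ := (Ioo (-vmax) (-vmin)).indicator fun v => (u - v) * t) (fun v => by
      by_cases h : v ∈ Ioo (-vmax) (-vmin)
      · have : {x | (x, v) ∈ hitR vmin vmax u t} = Ioc 0 ((u - v) * t) := by
          ext x; simp only [hitR, mem_ofPred_eq, mem_Ioc]; tauto
        rw [this, indicator_of_mem h, Measure.real, Real.volume_Ioc, ENNReal.toReal_ofReal] <;>
        nlinarith [mul_nonneg (show 0 ≤ u - v by linarith [h.2]) ht]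
      · have : {x | (x, v) ∈ hitR vmin vmax u t} = ∅ := by
          ext x; simp only [hitR, mem_ofPred_eq, mem_empty_iff_false]; tauto
        rw [this, indicator_of_notMem h]; simp)
  rw [e, integral_add iL iR, eL, eR, rate, mul_add]
  congr 1
  · rw [intervalIntegral.integral_of_le hv.le, integral_Ioc_eq_integral_Ioo,
      ← integral_const_mul, ← integral_indicator measurableSet_Ioo]
    refine integral_congr_ae (Eventually.of_forall fun v => ?_)
    by_cases h : v ∈ Ioo vmin vmax
    · simp only [indicator_of_mem h]; ring
    · simp only [indicator_of_notMem h, mul_zero]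
  · rw [intervalIntegral.integral_of_le (neg_le_neg hv.le), integral_Ioc_eq_integral_Ioo,
      ← integral_const_mul, ← integral_indicator measurableSet_Ioo]
    refine integral_congr_ae (Eventually.of_forall fun v => ?_)
    by_cases h : v ∈ Ioo (-vmax) (-vmin)
    · simp only [indicator_of_mem h]; ring
    · simp only [indicator_of_notMem h, mul_zero]

/-- The mean of a quantity that changes by `gL v` or `gR v` when a single atom can reach the
piston. -/
theorem abs_integral_sub_rate_le (hL : IsGasDensity vmin vmax pL)
    (hR : IsGasDensity vmin vmax pR) (hv : vmin < vmax) (hV0 : 0 < Vbar)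
    (hV : Vbar < vmin) {Ω : Type*} [MeasurableSpace Ω] {P : Measure Ω} [IsProbabilityMeasure P]
    {Γ : Ω → Set (ℝ × ℝ)} (h : IsPoissonProcess Γ (gasIntensity pL pR) P)
    {u t K : ℝ} (ht : 0 ≤ t) (hu : |u| ≤ Vbar)
    {gL gR : ℝ → ℝ} (hgL : Measurable gL) (hgR : Measurable gR) (hK : 0 ≤ K)
    (hKL : ∀ v ∈ Ioo vmin vmax, |gL v| ≤ K) (hKR : ∀ v ∈ Ioo (-vmax) (-vmin), |gR v| ≤ K)
    {Y : Ω → ℝ} (hY : AEStronglyMeasurable Y P)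
    (hb : ∀ᵐ ω ∂P, (Γ ω ∩ window vmax Vbar t).Finite →
      |Y ω| ≤ K * (Γ ω ∩ window vmax Vbar t).ncard)
    (hs : ∀ᵐ ω ∂P, ∀ z, Γ ω ∩ window vmax Vbar t = {z} →
      Y ω = hitValue vmin vmax u t gL gR z) :
    Integrable Y P ∧ |∫ ω, Y ω ∂P - t * rate vmin vmax pL pR u gL gR| ≤
      2 * K * (2 * (vmax + Vbar) * ((∫ v, pL v) + ∫ v, pR v)) ^ 2 * t ^ 2 := by
  have hle := gasIntensity_window_le (Vbar := Vbar) hL hR t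
  have hΛ : 0 ≤ (∫ v, pL v) + ∫ v, pR v :=
    add_nonneg (integral_nonneg hL.nonneg) (integral_nonneg hR.nonneg)
  have ht' : 0 ≤ 2 * (vmax + Vbar) * t := mul_nonneg (by linarith) ht
  rw [← ENNReal.ofReal_mul ht'] at hle
  have hne := ne_top_of_le_ne_top ENNReal.ofReal_ne_top hle
  have hle' := ENNReal.toReal_mono ENNReal.ofReal_ne_top hle
  rw [ENNReal.toReal_ofReal (mul_nonneg ht' hΛ)] at hle'
  obtain ⟨h1, h2⟩ := h.abs_integral_sub_le (measurableSet_window t) hne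
    (measurable_hitValue (vmin := vmin) (vmax := vmax) (u := u) (t := t) hgL hgR) hK
    (abs_hitValue_le hK hKL hKR) hY hb hs
  rw [integral_hitValue hL hR hv hV ht hu hgL hgR hKL hKR] at h2
  refine ⟨h1, h2.trans ?_⟩
  have h3 := mul_le_mul_of_nonneg_left (pow_le_pow_left₀ ENNReal.toReal_nonneg hle' 2)
    (show 0 ≤ 2 * K by linarith)
  refine h3.trans_eq ?_
  ring

end Intensity

theorem hasDerivWithinAt_of_quadratic {f : ℝ → ℝ} {L C : ℝ}
    (h : ∀ t, 0 ≤ t → |f t - t * L| ≤ C * t ^ 2) : HasDerivWithinAt f L (Ici 0) 0 := by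
  have h0 : f 0 = 0 := by simpa using h 0 le_rfl
  rw [hasDerivWithinAt_iff_isLittleO]
  simp only [h0, sub_zero, smul_eq_mul]
  have h1 : (fun t : ℝ => f t - t * L) =O[𝓝[≥] 0] fun t => t ^ 2 := by
    refine Asymptotics.IsBigO.of_bound C ?_
    filter_upwards [self_mem_nhdsWithin] with t ht
    simpa using h t ht
  exact h1.trans_isLittleO
    ((Asymptotics.isLittleO_pow_id one_lt_two).mono nhdsWithin_le_nhds)

theorem exists_abs_le_of_continuous {φ : ℝ → ℝ} (hφ : Continuous φ) (R : ℝ) :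
    ∃ B, 0 ≤ B ∧ ∀ x, |x| ≤ R → |φ x| ≤ B := by
  obtain ⟨B, hB⟩ := isCompact_Icc.exists_bound_of_continuousOn
    (hφ.continuousOn (s := Icc (-R) R))
  exact ⟨|B|, abs_nonneg _, fun x hx => (hB x (abs_le.1 hx)).trans (le_abs_self B)⟩

theorem IsStationary.ae_mem {Ω : Type*} [MeasurableSpace Ω] {P : Measure Ω} {Vbar : ℝ}
    {W : ℝ → Ω → ℝ → ℝ} {μ : Measure ℝ} (hμ : IsStationary P Vbar W μ) :
    ∀ᵐ u ∂μ, u ∈ Icc (-Vbar) Vbar :=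
  hμ.supp

theorem IsStationary.integrable {Ω : Type*} [MeasurableSpace Ω] {P : Measure Ω} {Vbar : ℝ}
    {W : ℝ → Ω → ℝ → ℝ} {μ : Measure ℝ} (hμ : IsStationary P Vbar W μ) {φ : ℝ → ℝ}
    (hφ : Continuous φ) : Integrable φ μ := by
  have := hμ.prob
  obtain ⟨B, hB0, hB⟩ := exists_abs_le_of_continuous hφ Vbar
  refine Integrable.of_bound hφ.aestronglyMeasurable B ?_
  filter_upwards [hμ.ae_mem] with u hu using hB u (abs_le.2 hu)

/-! ### Mean changes in a short time -/

section VelocityProcess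

variable {vmin vmax Vbar m M : ℝ} {pL pR : ℝ → ℝ}
  {Ω : Type*} [MeasurableSpace Ω] {P : Measure Ω} [IsProbabilityMeasure P]
  {Γ : Ω → Set (ℝ × ℝ)} {W : ℝ → Ω → ℝ → ℝ} {c : ℝ → Ω → ℝ × ℝ → ℝ → ℝ}

theorem Admissible.abs_atomAfter_le (hp : Admissible m M Vbar vmin vmax) {V v : ℝ}
    (hV : |V| ≤ Vbar) (hv : |v| ≤ vmax) : |atomAfter m M V v| ≤ 3 * vmax := by
  have hs : 0 < M + m := by linarith [hp.m_pos, hp.M_pos]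
  have e : atomAfter m M V v = (2 * M * V - (M - m) * v) / (M + m) := by
    unfold atomAfter; field_simp; ring
  have hmM : |M - m| ≤ M + m := abs_le.2 ⟨by linarith [hp.M_pos], by linarith [hp.m_pos]⟩
  rw [e, abs_div, abs_of_pos hs, div_le_iff₀ hs]
  refine (abs_sub _ _).trans ?_
  rw [abs_mul (2 * M), abs_mul (M - m), abs_of_pos (show 0 < 2 * M by linarith [hp.M_pos])]
  have h1 := mul_le_mul hmM hv (abs_nonneg v) hs.le
  have h2 := mul_le_mul_of_nonneg_left hV (show 0 ≤ 2 * M by linarith [hp.M_pos])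
  have h3 := mul_le_mul_of_nonneg_left (show Vbar ≤ vmax by linarith [hp.Vbar_lt, hp.vmin_lt])
    (show 0 ≤ 2 * M by linarith [hp.M_pos])
  nlinarith [mul_pos hp.m_pos (hp.vmin_pos.trans hp.vmin_lt)]

theorem Admissible.abs_le_of_mem_left (hp : Admissible m M Vbar vmin vmax) {v : ℝ}
    (hv : v ∈ Ioo vmin vmax) : |v| ≤ vmax :=
  abs_le.2 ⟨by linarith [hv.1, hv.2, hp.vmin_pos], hv.2.le⟩

theorem Admissible.abs_le_of_mem_right (hp : Admissible m M Vbar vmin vmax) {v : ℝ}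
    (hv : v ∈ Ioo (-vmax) (-vmin)) : |v| ≤ vmax :=
  abs_le.2 ⟨hv.1.le, by linarith [hv.1, hv.2, hp.vmin_pos, hp.vmin_lt]⟩

/-- The mean change of an additive functional of the velocities of the left gas. -/
theorem left_gain_estimate (hp : Admissible m M Vbar vmin vmax)
    (hL : IsGasDensity vmin vmax pL) (hR : IsGasDensity vmin vmax pR)
    (hP : IsPoissonProcess Γ (gasIntensity pL pR) P) (hW : IsPistonProcess P m M Vbar Γ W c)
    {ψ : ℝ → ℝ} (hψ : Continuous ψ) (hmeas : ∀ u ∈ Icc (-Vbar) Vbar, ∀ t, 0 ≤ t →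
      AEStronglyMeasurable (fun ω => ∑' z : {z : ℝ × ℝ // z ∈ Γ ω ∧ z.1 < 0},
        (ψ (c u ω z t) - ψ z.1.2)) P) :
    ∃ C, ∀ u ∈ Icc (-Vbar) Vbar, ∀ t, 0 ≤ t →
      Integrable (fun ω => ∑' z : {z : ℝ × ℝ // z ∈ Γ ω ∧ z.1 < 0},
        (ψ (c u ω z t) - ψ z.1.2)) P ∧
      |∫ ω, (∑' z : {z : ℝ × ℝ // z ∈ Γ ω ∧ z.1 < 0}, (ψ (c u ω z t) - ψ z.1.2)) ∂P -
        t * rate vmin vmax pL pR u (fun v => ψ (atomAfter m M u v) - ψ v) (fun _ => 0)| ≤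
        C * t ^ 2 := by
  -- The bound 3·vmax covers atomic velocities before and after a collision, so one atom changes the
  -- sum by at most 2B. Atoms from the right count with weight 0.
  obtain ⟨B, hB0, hB⟩ := exists_abs_le_of_continuous hψ (3 * vmax)
  have hvm : 0 < vmax := hp.vmin_pos.trans hp.vmin_lt
  refine ⟨_, fun u hu t ht => abs_integral_sub_rate_le hL hR hp.vmin_lt hp.Vbar_pos hp.Vbar_lt hP
    ht (abs_le.2 hu) ?_ measurable_const (K := 2 * B) (by linarith) ?_ ?_ (hmeas u hu t ht) ?_ ?_⟩
  · refine Continuous.measurable ?_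
    unfold atomAfter
    fun_prop
  · intro v hv
    refine (abs_sub _ _).trans ?_
    linarith [hB _ (hp.abs_atomAfter_le (abs_le.2 hu) (hp.abs_le_of_mem_left hv)),
      hB v (by linarith [hp.abs_le_of_mem_left hv])]
  · intro v _
    simpa using hB0
  · filter_upwards [hW.motion u hu, ae_gas hL hR hP] with ω hω hΓ hfin
    refine abs_tsum_window_le (F := fun z => ψ (c u ω z t) - ψ z.2) (by linarith)
      (fun z hz hzD => ?_) (fun z hz => ?_) hfin
    · rw [hω.atom_eq_of_notMem_window hp hΓ (abs_le.2 hu) hz ht hzD, sub_self]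
    · have hz2 := (hΓ z hz).2.2.le
      refine (abs_sub _ _).trans ?_
      have h1 : |c u ω z t| ≤ 3 * vmax := by
        rcases hω.atom_cases hp hΓ (abs_le.2 hu) hz ht with h | ⟨V, hV, h⟩
        · rw [h]; linarith
        · rw [h]; exact hp.abs_atomAfter_le hV hz2
      linarith [hB _ h1, hB z.2 (by linarith)]
  · filter_upwards [hW.motion u hu, ae_gas hL hR hP] with ω hω hΓ z hz
    rw [tsum_single_window (F := fun z => ψ (c u ω z t) - ψ z.2) (fun y hy hyD => by
      rw [hω.atom_eq_of_notMem_window hp hΓ (abs_le.2 hu) hy ht hyD, sub_self]) hz]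
    rcases hω.single_atom hp hΓ (abs_le.2 hu) ht hz with ⟨h1, h2, -⟩ | ⟨h1, h2, -⟩
    · rcases h1 with h1 | h1
      · rw [if_pos h1.1, hitValue_of_hitL h1, h2]
      · rw [if_neg (not_lt.2 h1.1.le), hitValue_of_hitR h1]
    · rw [hitValue_of_not_hit h1, h2, sub_self, ite_self]

theorem measurable_reflectVel (Vbar : ℝ) : Measurable (reflectVel Vbar) :=
  Measurable.ite (measurableSet_lt measurable_const measurable_id)
    (measurable_const.sub measurable_id)
    (Measurable.ite (measurableSet_lt measurable_id measurable_const)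
      (measurable_const.sub measurable_id) measurable_id)

/-- The change of the function `φ` of the velocity of the piston in a collision. -/
noncomputable def jump (m M Vbar : ℝ) (φ : ℝ → ℝ) (u v : ℝ) : ℝ :=
  φ (reflectVel Vbar (pistonAfter m M u v)) - φ u

theorem measurable_jump {φ : ℝ → ℝ} (hφ : Continuous φ) (u : ℝ) :
    Measurable (jump m M Vbar φ u) := by
  refine (hφ.measurable.comp ((measurable_reflectVel Vbar).comp ?_)).sub_const _
  unfold pistonAfter
  fun_prop

theorem exists_abs_sub_le_of_continuous {φ : ℝ → ℝ}
    (hφ : Continuous φ) (Vbar : ℝ) : ∃ K, 0 ≤ K ∧ ∀ u ∈ Icc (-Vbar) Vbar, ∀ w, |w| ≤ Vbar →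
      |φ w - φ u| ≤ K := by
  obtain ⟨B, hB0, hB⟩ := exists_abs_le_of_continuous hφ Vbar
  refine ⟨2 * B, by linarith, fun u hu w hw => (abs_sub _ _).trans ?_⟩
  linarith [hB w hw, hB u (abs_le.2 hu)]

/-- The mean change of a function of the velocity of the piston. -/
theorem piston_estimate (hp : Admissible m M Vbar vmin vmax)
    (hL : IsGasDensity vmin vmax pL) (hR : IsGasDensity vmin vmax pR)
    (hP : IsPoissonProcess Γ (gasIntensity pL pR) P) (hW : IsPistonProcess P m M Vbar Γ W c)
    {φ : ℝ → ℝ} (hφ : Continuous φ) :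
    ∃ C, ∀ u ∈ Icc (-Vbar) Vbar, ∀ t, 0 ≤ t →
      Integrable (fun ω => φ (W u ω t) - φ u) P ∧
      |∫ ω, (φ (W u ω t) - φ u) ∂P -
        t * rate vmin vmax pL pR u (jump m M Vbar φ u) (jump m M Vbar φ u)| ≤ C * t ^ 2 := by
  obtain ⟨K, hK0, hK⟩ := exists_abs_sub_le_of_continuous hφ Vbar
  refine ⟨_, fun u hu t ht => abs_integral_sub_rate_le hL hR hp.vmin_lt hp.Vbar_pos hp.Vbar_lt hP
    ht (abs_le.2 hu) (measurable_jump hφ u) (measurable_jump hφ u) hK0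
    (fun v hv => hK u hu _ (hp.abs_reflectVel_le (abs_le.2 hu) (hp.abs_le_of_mem_left hv)))
    (fun v hv => hK u hu _ (hp.abs_reflectVel_le (abs_le.2 hu) (hp.abs_le_of_mem_right hv)))
    ?_ ?_ ?_⟩
  · exact ((hφ.measurable.comp ((hW.measurable_velocity t ht).comp
      measurable_prodMk_left)).sub_const _).aestronglyMeasurable
  · filter_upwards [hW.motion u hu, ae_gas hL hR hP] with ω hω hΓ hfin
    -- The change is bounded by K in any case. It vanishes when no atom is within reach, and
    -- otherwise the number of atoms is at least 1.
    by_cases he : Γ ω ∩ window vmax Vbar t = ∅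
    · rw [hω.piston_eq_of_empty hp hΓ (abs_le.2 hu) ht he, he]
      simp
    · have h1 : 1 ≤ (Γ ω ∩ window vmax Vbar t).ncard :=
        Nat.one_le_iff_ne_zero.2 fun h => he ((ncard_eq_zero hfin).1 h)
      have h2 : (1 : ℝ) ≤ (Γ ω ∩ window vmax Vbar t).ncard := by exact_mod_cast h1
      have := mul_le_mul_of_nonneg_left h2 hK0
      linarith [hK u hu _ (hω.abs_piston_le hp hΓ (abs_le.2 hu) t ht)]
  · filter_upwards [hW.motion u hu, ae_gas hL hR hP] with ω hω hΓ z hz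
    rcases hω.single_atom hp hΓ (abs_le.2 hu) ht hz with ⟨h1, -, h2⟩ | ⟨h1, -, h2⟩
    · rw [h2]
      rcases h1 with h1 | h1
      · rw [hitValue_of_hitL h1, jump]
      · rw [hitValue_of_hitR h1, jump]
    · rw [hitValue_of_not_hit h1, h2, sub_self]

/-! ### Stationary measures -/

variable {μ : Measure ℝ}

/-- Invariance under the transition probabilities becomes a statement on a product space: if u has
law μ and is independent of the gas, the velocity at time t again has law μ. -/
theorem IsStationary.map_prod (hμ : IsStationary P Vbar W μ)
    (hW : IsPistonProcess P m M Vbar Γ W c) {t : ℝ} (ht : 0 ≤ t) :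
    (μ.prod P).map (fun q => W q.1 q.2 t) = μ := by
  have := hμ.prob
  have hm := hW.measurable_velocity t ht
  refine Measure.ext fun A hA => ?_
  rw [Measure.map_apply hm hA, Measure.prod_apply (hm hA), ← hμ.invariant t ht A hA]
  refine lintegral_congr fun u => ?_
  exact (Measure.map_apply (hm.comp measurable_prodMk_left) hA).symm

/-- By stationarity 0 = ∫ (E φ(W t) - φ) dμ ≤ t∫ψ dμ + Ct²; divide by t and let t → 0. The
uniformity of C in u is essential. Only the continuous majorant ψ of the rate is integrated, so
upper bounds for the effect of the reflection suffice. -/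
theorem IsStationary.integral_nonneg_of_rate_le (hμ : IsStationary P Vbar W μ)
    (hp : Admissible m M Vbar vmin vmax)
    (hL : IsGasDensity vmin vmax pL) (hR : IsGasDensity vmin vmax pR)
    (hP : IsPoissonProcess Γ (gasIntensity pL pR) P) (hW : IsPistonProcess P m M Vbar Γ W c)
    {φ ψ : ℝ → ℝ} (hφ : Continuous φ) (hψ : Continuous ψ)
    (hle : ∀ u ∈ Icc (-Vbar) Vbar,
      rate vmin vmax pL pR u (jump m M Vbar φ u) (jump m M Vbar φ u) ≤ ψ u) :
    0 ≤ ∫ u, ψ u ∂μ := by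
  have := hμ.prob
  obtain ⟨C, hC⟩ := piston_estimate hp hL hR hP hW hφ
  have hφμ := hμ.integrable hφ
  have hψμ := hμ.integrable hψ
  have key : ∀ t : ℝ, 0 < t → 0 ≤ (∫ u, ψ u ∂μ) + C * t := by
    intro t ht
    have hmap := hμ.map_prod hW ht.le
    have hm := hW.measurable_velocity t ht.le
    have hint : Integrable (fun q : ℝ × Ω => φ (W q.1 q.2 t)) (μ.prod P) := by
      have h1 := hφμ
      rw [← hmap] at h1
      exact h1.comp_measurable hm
    have h1 : ∫ u, ∫ ω, φ (W u ω t) ∂P ∂μ = ∫ u, φ u ∂μ := by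
      rw [← integral_prod _ hint]
      conv_rhs => rw [← hmap]
      rw [integral_map hm.aemeasurable hφ.aestronglyMeasurable]
    have h2 : ∫ u, ∫ ω, φ (W u ω t) ∂P ∂μ ≤ ∫ u, (φ u + (t * ψ u + C * t ^ 2)) ∂μ := by
      refine integral_mono_ae hint.integral_prod_left
        (hφμ.add ((hψμ.const_mul t).add (integrable_const _))) ?_
      filter_upwards [hμ.ae_mem] with u hu
      obtain ⟨h3, h4⟩ := hC u hu t ht.le
      have h5 : Integrable (fun ω => φ (W u ω t)) P := by
        refine (h3.add (integrable_const (φ u))).congr (Eventually.of_forall fun ω => ?_)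
        simp
      rw [integral_sub h5 (integrable_const _), integral_const, probReal_univ, one_smul] at h4
      have h6 := (abs_le.1 h4).2
      have h7 := mul_le_mul_of_nonneg_left (hle u hu) ht.le
      linarith
    have h9 : ∫ u, (φ u + (t * ψ u + C * t ^ 2)) ∂μ =
        (∫ u, φ u ∂μ) + (t * (∫ u, ψ u ∂μ) + C * t ^ 2) := by
      have e : ∫ u, (t * ψ u + C * t ^ 2) ∂μ = t * (∫ u, ψ u ∂μ) + C * t ^ 2 := by
        rw [integral_add (hψμ.const_mul t) (integrable_const _), integral_const_mul,
          integral_const, probReal_univ, one_smul]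
      rw [← e]
      exact integral_add hφμ ((hψμ.const_mul t).add (integrable_const _))
    rw [h1, h9] at h2
    have h8 : 0 ≤ t * ((∫ u, ψ u ∂μ) + C * t) := by nlinarith
    exact nonneg_of_mul_nonneg_right h8 ht
  have hlim : Tendsto (fun t : ℝ => (∫ u, ψ u ∂μ) + C * t) (𝓝[>] 0)
      (𝓝 ((∫ u, ψ u ∂μ) + C * 0)) :=
    ((continuous_const.add (continuous_const.mul continuous_id)).tendsto 0).mono_left
      nhdsWithin_le_nhds
  rw [mul_zero, add_zero] at hlim
  exact ge_of_tendsto hlim (by filter_upwards [self_mem_nhdsWithin] with t ht using key t ht)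

end VelocityProcess

/-! ### Moments of the gas relative to the velocity of the piston -/

/-- The moment of order `j` of `v - u` for the density `p` on `[a, b]`. -/
noncomputable def relMoment (a b : ℝ) (p : ℝ → ℝ) (j : ℕ) (u : ℝ) : ℝ :=
  ∫ v in a..b, (v - u) ^ j * p v

section RelMoment

variable {a b : ℝ} {p : ℝ → ℝ}

theorem intervalIntegrable_continuous_mul (hp : Integrable p) {h : ℝ → ℝ} (hh : Continuous h) :
    IntervalIntegrable (fun v => h v * p v) volume a b :=
  hp.intervalIntegrable.continuousOn_mul hh.continuousOn

theorem integral_mul_quartic (hp : Integrable p) (u c₀ c₁ c₂ c₃ c₄ : ℝ) :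
    ∫ v in a..b, (v - u) * (c₀ + c₁ * (v - u) + c₂ * (v - u) ^ 2 + c₃ * (v - u) ^ 3 +
      c₄ * (v - u) ^ 4) * p v =
    c₀ * relMoment a b p 1 u + c₁ * relMoment a b p 2 u + c₂ * relMoment a b p 3 u +
      c₃ * relMoment a b p 4 u + c₄ * relMoment a b p 5 u := by
  have hi : ∀ j : ℕ, IntervalIntegrable (fun v => (v - u) ^ j * p v) volume a b := fun j =>
    intervalIntegrable_continuous_mul hp (by fun_prop)
  unfold relMoment
  simp only [← intervalIntegral.integral_const_mul]
  rw [← intervalIntegral.integral_add ((hi 1).const_mul _) ((hi 2).const_mul _),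
    ← intervalIntegral.integral_add (((hi 1).const_mul _).add ((hi 2).const_mul _))
      ((hi 3).const_mul _),
    ← intervalIntegral.integral_add ((((hi 1).const_mul _).add ((hi 2).const_mul _)).add
      ((hi 3).const_mul _)) ((hi 4).const_mul _),
    ← intervalIntegral.integral_add (((((hi 1).const_mul _).add ((hi 2).const_mul _)).add
      ((hi 3).const_mul _)).add ((hi 4).const_mul _)) ((hi 5).const_mul _)]
  refine intervalIntegral.integral_congr fun v _ => ?_
  ring

theorem relMoment_two (hp : Integrable p) (u : ℝ) :
    relMoment a b p 2 u = (∫ v in a..b, v ^ 2 * p v) - 2 * u * (∫ v in a..b, v ^ 1 * p v) +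
      u ^ 2 * ∫ v in a..b, v ^ 0 * p v := by
  have hi : ∀ j : ℕ, IntervalIntegrable (fun v => v ^ j * p v) volume a b := fun j =>
    intervalIntegrable_continuous_mul hp (by fun_prop)
  unfold relMoment
  simp only [← intervalIntegral.integral_const_mul]
  rw [← intervalIntegral.integral_sub (hi 2) ((hi 1).const_mul _),
    ← intervalIntegral.integral_add ((hi 2).sub ((hi 1).const_mul _)) ((hi 0).const_mul _)]
  refine intervalIntegral.integral_congr fun v _ => ?_
  ring

theorem relMoment_three (hp : Integrable p) (u : ℝ) :
    relMoment a b p 3 u = (∫ v in a..b, v ^ 3 * p v) - 3 * u * (∫ v in a..b, v ^ 2 * p v) +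
      3 * u ^ 2 * (∫ v in a..b, v ^ 1 * p v) - u ^ 3 * ∫ v in a..b, v ^ 0 * p v := by
  have hi : ∀ j : ℕ, IntervalIntegrable (fun v => v ^ j * p v) volume a b := fun j =>
    intervalIntegrable_continuous_mul hp (by fun_prop)
  unfold relMoment
  simp only [← intervalIntegral.integral_const_mul]
  rw [← intervalIntegral.integral_sub (hi 3) ((hi 2).const_mul _),
    ← intervalIntegral.integral_add ((hi 3).sub ((hi 2).const_mul _)) ((hi 1).const_mul _),
    ← intervalIntegral.integral_sub (((hi 3).sub ((hi 2).const_mul _)).add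
      ((hi 1).const_mul _)) ((hi 0).const_mul _)]
  refine intervalIntegral.integral_congr fun v _ => ?_
  ring

theorem abs_relMoment_le (hp : Integrable p) (hp0 : ∀ v, 0 ≤ p v) (hab : a ≤ b) {u L : ℝ}
    (hL : ∀ v ∈ Icc a b, |v - u| ≤ L) (j : ℕ) :
    |relMoment a b p j u| ≤ L ^ j * ∫ v in a..b, v ^ 0 * p v := by
  rw [← intervalIntegral.integral_const_mul]
  refine (intervalIntegral.abs_integral_le_integral_abs hab).trans
    (intervalIntegral.integral_mono_on hab ?_ ?_ fun v hv => ?_)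
  · exact (intervalIntegrable_continuous_mul hp (by fun_prop)).abs
  · exact (intervalIntegrable_continuous_mul hp (by fun_prop)).const_mul _
  · rw [abs_mul, abs_of_nonneg (hp0 v), abs_pow, pow_zero, one_mul]
    exact mul_le_mul_of_nonneg_right (pow_le_pow_left₀ (abs_nonneg _) (hL v hv) j) (hp0 v)

end RelMoment

/-! ### Collision rates in terms of moment differences -/

section Rate

variable {vmin vmax Vbar m M : ℝ} {pL pR : ℝ → ℝ}

/-- The difference of the relative moments of the two gases. -/
noncomputable def relDiff (vmin vmax : ℝ) (pL pR : ℝ → ℝ) (j : ℕ) (u : ℝ) : ℝ :=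
  relMoment vmin vmax pL j u - relMoment (-vmax) (-vmin) pR j u

theorem intervalIntegrable_bounded_mul {p : ℝ → ℝ} (hp : IsGasDensity vmin vmax p) {a b u K : ℝ}
    (hab : a ≤ b) {g : ℝ → ℝ} (hg : Measurable g) (hK : ∀ v ∈ Ioo a b, |g v| ≤ K) :
    IntervalIntegrable (fun v => (v - u) * g v * p v) volume a b := by
  have h1 : IntervalIntegrable (fun v => g v * p v) volume a b := by
    rw [intervalIntegrable_iff_integrableOn_Ioo_of_le hab,
      ← integrable_indicator_iff measurableSet_Ioo]
    exact integrable_indicator_mul hp hg measurableSet_Ioo hK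
  simp only [mul_assoc]
  exact h1.continuousOn_mul (by fun_prop)

/-- The flux weights v - u on the left and u - v on the right are nonnegative because |u| ≤ Vbar <
vmin, so a pointwise bound integrates. The opposite sign of the right weight produces differences of
the moments of the two gases. -/
theorem rate_le_of_le_quartic (hp : Admissible m M Vbar vmin vmax)
    (hL : IsGasDensity vmin vmax pL) (hR : IsGasDensity vmin vmax pR) {u K : ℝ}
    (hu : |u| ≤ Vbar) {g : ℝ → ℝ} (hg : Measurable g) (hK : ∀ v, |v| ≤ vmax → |g v| ≤ K)
    {c₀ c₁ c₂ c₃ c₄ : ℝ} (hle : ∀ v, |v| ≤ vmax → g v ≤ c₀ + c₁ * (v - u) + c₂ * (v - u) ^ 2 +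
      c₃ * (v - u) ^ 3 + c₄ * (v - u) ^ 4) :
    rate vmin vmax pL pR u g g ≤ c₀ * relDiff vmin vmax pL pR 1 u +
      c₁ * relDiff vmin vmax pL pR 2 u + c₂ * relDiff vmin vmax pL pR 3 u +
      c₃ * relDiff vmin vmax pL pR 4 u + c₄ * relDiff vmin vmax pL pR 5 u := by
  have hv := hp.vmin_lt
  have hu' := abs_le.1 hu
  have hV := hp.Vbar_lt
  have h1 : ∫ v in vmin..vmax, (v - u) * g v * pL v ≤
      ∫ v in vmin..vmax, (v - u) * (c₀ + c₁ * (v - u) + c₂ * (v - u) ^ 2 + c₃ * (v - u) ^ 3 +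
        c₄ * (v - u) ^ 4) * pL v := by
    refine intervalIntegral.integral_mono_on_of_le_Ioo hv.le
      (intervalIntegrable_bounded_mul hL hv.le hg fun v hv => hK v (hp.abs_le_of_mem_left hv))
      (intervalIntegrable_continuous_mul hL.integrable (by fun_prop)) fun v hv => ?_
    exact mul_le_mul_of_nonneg_right (mul_le_mul_of_nonneg_left
      (hle v (hp.abs_le_of_mem_left hv)) (by linarith [hv.1])) (hL.nonneg v)
  have h2 : ∫ v in (-vmax)..(-vmin), (v - u) * (c₀ + c₁ * (v - u) + c₂ * (v - u) ^ 2 +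
        c₃ * (v - u) ^ 3 + c₄ * (v - u) ^ 4) * pR v ≤
      ∫ v in (-vmax)..(-vmin), (v - u) * g v * pR v := by
    refine intervalIntegral.integral_mono_on_of_le_Ioo (neg_le_neg hv.le)
      (intervalIntegrable_continuous_mul hR.integrable (by fun_prop))
      (intervalIntegrable_bounded_mul hR (neg_le_neg hv.le) hg
        fun v hv => hK v (hp.abs_le_of_mem_right hv)) fun v hv => ?_
    exact mul_le_mul_of_nonneg_right (mul_le_mul_of_nonpos_left
      (hle v (hp.abs_le_of_mem_right hv)) (by linarith [hv.2])) (hR.nonneg v)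
  have h3 : ∫ v in (-vmax)..(-vmin), (u - v) * g v * pR v =
      -∫ v in (-vmax)..(-vmin), (v - u) * g v * pR v := by
    rw [← intervalIntegral.integral_neg]
    refine intervalIntegral.integral_congr fun v _ => ?_
    ring
  rw [integral_mul_quartic hL.integrable] at h1
  rw [integral_mul_quartic hR.integrable] at h2
  rw [rate, h3]
  unfold relDiff
  linarith

theorem abs_relDiff_le (hp : Admissible m M Vbar vmin vmax)
    (hL : IsGasDensity vmin vmax pL) (hR : IsGasDensity vmin vmax pR) {u : ℝ}
    (hu : |u| ≤ Vbar) (j : ℕ) : |relDiff vmin vmax pL pR j u| ≤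
      (vmax + Vbar) ^ j * (momentL vmin vmax pL 0 + momentR vmin vmax pR 0) := by
  have hv := hp.vmin_lt
  have h0 := hp.vmin_pos
  have hu' := abs_le.1 hu
  have h1 := abs_relMoment_le hL.integrable hL.nonneg hv.le (u := u) (L := vmax + Vbar)
    (fun v hv => abs_le.2 ⟨by linarith [hv.1, hv.2], by linarith [hv.1, hv.2]⟩) j
  have h2 := abs_relMoment_le hR.integrable hR.nonneg (neg_le_neg hv.le) (u := u)
    (L := vmax + Vbar)
    (fun v hv => abs_le.2 ⟨by linarith [hv.1, hv.2], by linarith [hv.1, hv.2]⟩) j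
  unfold relDiff momentL momentR
  refine (abs_sub _ _).trans ?_
  linarith

theorem relDiff_two (hL : Integrable pL) (hR : Integrable pR) (u : ℝ) :
    relDiff vmin vmax pL pR 2 u =
      (momentL vmin vmax pL 2 - momentR vmin vmax pR 2) -
      2 * u * (momentL vmin vmax pL 1 - momentR vmin vmax pR 1) +
      u ^ 2 * (momentL vmin vmax pL 0 - momentR vmin vmax pR 0) := by
  rw [relDiff, relMoment_two hL, relMoment_two hR]
  unfold momentL momentR
  ring

theorem relDiff_three (hL : Integrable pL) (hR : Integrable pR) (u : ℝ) :
    relDiff vmin vmax pL pR 3 u =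
      (momentL vmin vmax pL 3 - momentR vmin vmax pR 3) -
      3 * u * (momentL vmin vmax pL 2 - momentR vmin vmax pR 2) +
      3 * u ^ 2 * (momentL vmin vmax pL 1 - momentR vmin vmax pR 1) -
      u ^ 3 * (momentL vmin vmax pL 0 - momentR vmin vmax pR 0) := by
  rw [relDiff, relMoment_three hL, relMoment_three hR]
  unfold momentL momentR
  ring

/-- On the domains of integration |v| ≥ vmin, and F_1^+ is negative. Consequently vmin·|Q₀| ≤ Q₁,
and Q₁ > 0 as soon as there are atoms on the left. -/
theorem vmin_mul_moment_le (hv : vmin ≤ vmax) (hL : IsGasDensity vmin vmax pL)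
    (hR : IsGasDensity vmin vmax pR) :
    vmin * momentL vmin vmax pL 0 ≤ momentL vmin vmax pL 1 ∧
      vmin * momentR vmin vmax pR 0 ≤ -momentR vmin vmax pR 1 ∧
      0 ≤ momentL vmin vmax pL 0 ∧ 0 ≤ momentR vmin vmax pR 0 := by
  unfold momentL momentR
  refine ⟨?_, ?_, ?_, ?_⟩
  · rw [← intervalIntegral.integral_const_mul]
    refine intervalIntegral.integral_mono_on hv
      ((intervalIntegrable_continuous_mul hL.integrable (by fun_prop)).const_mul _)
      (intervalIntegrable_continuous_mul hL.integrable (by fun_prop)) fun v hv => ?_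
    rw [pow_zero, one_mul, pow_one]
    exact mul_le_mul_of_nonneg_right hv.1 (hL.nonneg v)
  · rw [← intervalIntegral.integral_const_mul, ← intervalIntegral.integral_neg]
    refine intervalIntegral.integral_mono_on (neg_le_neg hv)
      ((intervalIntegrable_continuous_mul hR.integrable (by fun_prop)).const_mul _)
      (intervalIntegrable_continuous_mul hR.integrable (by fun_prop)).neg fun v hv => ?_
    rw [pow_zero, one_mul, pow_one, ← neg_mul]
    exact mul_le_mul_of_nonneg_right (by linarith [hv.2]) (hR.nonneg v)
  · exact intervalIntegral.integral_nonneg hv fun v _ => by simpa using hL.nonneg v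
  · exact intervalIntegral.integral_nonneg (neg_le_neg hv) fun v _ => by simpa using hR.nonneg v

/-- Half of the mass of an even density belongs to positive velocities. -/
theorem momentL_zero_pos {f p : ℝ → ℝ} (hv : 0 < vmin) (hvv : vmin < vmax)
    (hf : IsVelocityDensity vmin vmax f) {n : ℝ} (hn : 0 < n) (hp : ∀ v, p v = n * f v) :
    0 < momentL vmin vmax p 0 := by
  have h1 : ∫ v, f |v| = 1 := by
    rw [← hf.integral_eq_one]
    refine integral_congr_ae (Eventually.of_forall fun v => ?_)
    rcases abs_choice v with h | h
    · simp only [h]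
    · simp only [h, hf.even]
  rw [integral_comp_abs] at h1
  have h2 : ∫ v in Ioi (0 : ℝ), f v = ∫ v in Ioc vmin vmax, f v := by
    refine setIntegral_eq_of_subset_of_forall_sdiff_eq_zero measurableSet_Ioi
      (fun v hv' => hv.trans hv'.1) fun v hv' => hf.cutoff v ?_
    have h3 : 0 < v := hv'.1
    rw [abs_of_pos h3]
    by_contra hc
    push Not at hc
    exact hv'.2 ⟨hc.1, hc.2.le⟩
  have h3 : momentL vmin vmax p 0 = n * ∫ v in Ioc vmin vmax, f v := by
    rw [momentL, ← intervalIntegral.integral_of_le hvv.le, ← intervalIntegral.integral_const_mul]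
    refine intervalIntegral.integral_congr fun v _ => ?_
    simp [hp]
  rw [h3, ← h2]
  exact mul_pos hn (by linarith)

end Rate

/-! ### The reflection at the cutoff -/

/-- This lets the reflection be dropped in upper bounds for even powers of the velocity. -/
theorem abs_reflectVel_le_abs {Vbar w : ℝ} (hV : 0 ≤ Vbar) : |reflectVel Vbar w| ≤ |w| := by
  unfold reflectVel
  split_ifs with h1 h2
  · rw [abs_of_pos (hV.trans_lt h1)]
    exact abs_le.2 ⟨by linarith, by linarith⟩
  · rw [abs_of_neg (show w < 0 by linarith)]
    exact abs_le.2 ⟨by linarith, by linarith⟩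
  · exact le_rfl

/-- The reflection acts only if the velocity is far from `0`. -/
theorem abs_reflectVel_sub_le {Vbar u w d : ℝ} (hV : 0 < Vbar) (hu : |u| ≤ Vbar)
    (hw : |w - u| ≤ d) (hd : d ≤ Vbar / 2) :
    |reflectVel Vbar w - w| ≤ 32 / Vbar ^ 4 * d * u ^ 4 := by
  have hd0 : 0 ≤ d := (abs_nonneg _).trans hw
  rw [abs_le] at hu hw
  -- A reflection needs |u| ≥ Vbar - d ≥ Vbar/2 and moves the velocity by at most 2d. Then
  -- 16u⁴/Vbar⁴ ≥ 1, which gives the constant 32 = 2·16. The fourth power is chosen because b₄ =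
  -- O(a²).
  have key : Vbar / 2 ≤ |u| → 2 * d ≤ 32 / Vbar ^ 4 * d * u ^ 4 := by
    intro h
    have h1 := pow_le_pow_left₀ (by linarith : 0 ≤ Vbar / 2) h 4
    rw [Even.pow_abs (by decide : Even 4)] at h1
    have h2 : Vbar ^ 4 ≤ 16 * u ^ 4 := by
      have : (Vbar / 2) ^ 4 = Vbar ^ 4 / 16 := by ring
      linarith
    have h3 : 32 / Vbar ^ 4 * d * u ^ 4 = 2 * d * (16 * u ^ 4 / Vbar ^ 4) := by ring
    rw [h3]
    have h4 : 1 ≤ 16 * u ^ 4 / Vbar ^ 4 := by rwa [one_le_div (by positivity)]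
    nlinarith
  unfold reflectVel
  split_ifs with h1 h2
  · refine le_trans (abs_le.2 ⟨by linarith, by linarith⟩)
      (key (le_trans (by linarith) (le_abs_self u)))
  · refine le_trans (abs_le.2 ⟨by linarith, by linarith⟩)
      (key (le_trans (by linarith) (neg_le_abs u)))
  · rw [sub_self, abs_zero]
    positivity

/-! ### Relations between the moments of a stationary measure -/

/-- Relations between the first four moments `b₁, …, b₄` of a stationary measure, with
`a = 2 m / (M + m)` and the moment differences `Q₀`, `Q₁`, `Q₃` of the gases. -/
structure MomentRelations (a V B κ Q₀ Q₁ Q₃ b₁ b₂ b₃ b₄ : ℝ) : Prop where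
  b₂_nonneg : 0 ≤ b₂
  b₄_nonneg : 0 ≤ b₄
  abs_b₃_le : |b₃| ≤ V * b₂
  second_le : 10 / 3 * Q₁ * b₂ ≤ a * B
  fourth_le : 20 / 3 * Q₁ * b₄ ≤ 6 * a * B * b₂ + a ^ 2 * (B * (4 * V + 1))
  first : |-2 * Q₁ * b₁ + Q₀ * b₂| ≤ κ * B * b₄
  second : |-4 * Q₁ * b₂ + 2 * Q₀ * b₃ + a * (Q₃ + 3 * Q₁ * b₂ - Q₀ * b₃)| ≤ 3 * V * κ * B * b₄
  third : |-6 * Q₁ * b₃ + 3 * Q₀ * b₄ + a * (3 * Q₃ * b₁ + 9 * Q₁ * b₃ - 3 * Q₀ * b₄)| ≤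
    a ^ 2 * B + 7 * V ^ 2 * κ * B * b₄

/-! ### Test functions u, u², u³, u⁴ in the stationarity condition -/

section VelocityProcess

variable {vmin vmax Vbar m M : ℝ} {pL pR : ℝ → ℝ}
  {Ω : Type*} [MeasurableSpace Ω] {P : Measure Ω} [IsProbabilityMeasure P]
  {Γ : Ω → Set (ℝ × ℝ)} {W : ℝ → Ω → ℝ → ℝ} {c : ℝ → Ω → ℝ × ℝ → ℝ → ℝ} {μ : Measure ℝ}

theorem IsStationary.integral_quartic {Ω : Type*} [MeasurableSpace Ω] {P : Measure Ω}
    {W : ℝ → Ω → ℝ → ℝ} (hμ : IsStationary P Vbar W μ) (α₀ α₁ α₂ α₃ α₄ : ℝ) :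
    ∫ u, (α₀ + α₁ * u + α₂ * u ^ 2 + α₃ * u ^ 3 + α₄ * u ^ 4) ∂μ =
      α₀ + α₁ * (∫ u, u ∂μ) + α₂ * (∫ u, u ^ 2 ∂μ) + α₃ * (∫ u, u ^ 3 ∂μ) +
        α₄ * ∫ u, u ^ 4 ∂μ := by
  have := hμ.prob
  have h : ∀ {φ : ℝ → ℝ}, Continuous φ → Integrable φ μ := hμ.integrable
  rw [integral_add (h (by fun_prop)) (h (by fun_prop)),
    integral_add (h (by fun_prop)) (h (by fun_prop)),
    integral_add (h (by fun_prop)) (h (by fun_prop)),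
    integral_add (h (by fun_prop)) (h (by fun_prop))]
  simp only [integral_const_mul, integral_const, probReal_univ, one_smul]
  rw [integral_const_mul α₁ (fun u => u)]

theorem IsStationary.moments_nonneg (hμ : IsStationary P Vbar W μ)
    (hp : Admissible m M Vbar vmin vmax)
    (hL : IsGasDensity vmin vmax pL) (hR : IsGasDensity vmin vmax pR)
    (hP : IsPoissonProcess Γ (gasIntensity pL pR) P) (hW : IsPistonProcess P m M Vbar Γ W c)
    {φ : ℝ → ℝ} (hφ : Continuous φ) {c₀ c₁ c₂ c₃ c₄ : ℝ → ℝ} {α₀ α₁ α₂ α₃ α₄ : ℝ}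
    (hjump : ∀ u, |u| ≤ Vbar → ∀ v, |v| ≤ vmax → jump m M Vbar φ u v ≤
      c₀ u + c₁ u * (v - u) + c₂ u * (v - u) ^ 2 + c₃ u * (v - u) ^ 3 + c₄ u * (v - u) ^ 4)
    (hle : ∀ u, |u| ≤ Vbar → c₀ u * relDiff vmin vmax pL pR 1 u +
      c₁ u * relDiff vmin vmax pL pR 2 u + c₂ u * relDiff vmin vmax pL pR 3 u +
      c₃ u * relDiff vmin vmax pL pR 4 u + c₄ u * relDiff vmin vmax pL pR 5 u ≤
        α₀ + α₁ * u + α₂ * u ^ 2 + α₃ * u ^ 3 + α₄ * u ^ 4) :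
    0 ≤ α₀ + α₁ * (∫ u, u ∂μ) + α₂ * (∫ u, u ^ 2 ∂μ) + α₃ * (∫ u, u ^ 3 ∂μ) +
        α₄ * ∫ u, u ^ 4 ∂μ := by
  rw [← hμ.integral_quartic]
  obtain ⟨K, -, hK⟩ := exists_abs_sub_le_of_continuous hφ Vbar
  refine hμ.integral_nonneg_of_rate_le hp hL hR hP hW hφ (by fun_prop) fun u hu => ?_
  have hu' := abs_le.2 hu
  exact (rate_le_of_le_quartic hp hL hR hu' (measurable_jump hφ u)
    (fun v hv => hK u hu _ (hp.abs_reflectVel_le hu' hv)) (hjump u hu')).trans (hle u hu')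

/-- What a collision with the piston and the reflection do to the velocity of the piston. -/
theorem Admissible.collision_bounds (hp : Admissible m M Vbar vmin vmax) {u v : ℝ}
    (hu : |u| ≤ Vbar) (hv : |v| ≤ vmax) :
    ∃ r w, reflectVel Vbar (pistonAfter m M u v) = r ∧ w = u + 2 * m / (M + m) * (v - u) ∧
      |r| ≤ |w| ∧ |w| ≤ 3 / 2 * Vbar ∧
      |r - w| ≤ 32 / Vbar ^ 4 * (vmax + Vbar) * (2 * m / (M + m)) * u ^ 4 := by
  refine ⟨_, _, rfl, rfl, ?_⟩
  have h1 := hp.abs_pistonAfter_sub_le hu hv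
  rw [← hp.pistonAfter_eq]
  refine ⟨abs_reflectVel_le_abs hp.Vbar_pos.le, ?_, ?_⟩
  · have h2 := h1.trans hp.small
    rw [abs_le] at h2 hu ⊢
    constructor <;> linarith
  · refine (abs_reflectVel_sub_le hp.Vbar_pos hu h1 hp.small).trans_eq ?_
    ring

theorem Admissible.ratio_le_one (hp : Admissible m M Vbar vmin vmax) :
    2 * m / (M + m) ≤ 1 := by
  have h1 := hp.small
  have h2 : Vbar / 2 ≤ 1 * (vmax + Vbar) := by
    linarith [hp.Vbar_pos, hp.vmin_pos, hp.vmin_lt]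
  exact le_of_mul_le_mul_right (h1.trans h2)
    (by linarith [hp.Vbar_pos, hp.vmin_pos, hp.vmin_lt])

-- Each relation tests stationarity with a power of u, where the mean change is expanded in w - u =
-- a(v - u). For the upper bounds on b₂ and b₄ the reflection is simply dropped; for the three
-- two-sided relations it is an error κ·a·u⁴ per collision, up to a factor from the power. A common
-- factor a is cancelled throughout.
set_option maxHeartbeats 1000000 in
theorem IsStationary.momentRelations (hμ : IsStationary P Vbar W μ)
    (hp : Admissible m M Vbar vmin vmax)
    (hL : IsGasDensity vmin vmax pL) (hR : IsGasDensity vmin vmax pR)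
    (hP : IsPoissonProcess Γ (gasIntensity pL pR) P) (hW : IsPistonProcess P m M Vbar Γ W c)
    {Q : ℕ → ℝ} (hQ : ∀ k, Q k = momentL vmin vmax pL k - momentR vmin vmax pR k)
    (hQ2 : Q 2 = 0) :
    MomentRelations (2 * m / (M + m)) Vbar
      ((vmax + Vbar + 1) ^ 5 * (momentL vmin vmax pL 0 + momentR vmin vmax pR 0))
      (32 / Vbar ^ 4 * (vmax + Vbar)) (Q 0) (Q 1) (Q 3)
      (∫ u, u ∂μ) (∫ u, u ^ 2 ∂μ) (∫ u, u ^ 3 ∂μ) (∫ u, u ^ 4 ∂μ) := by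
  have hprob := hμ.prob
  set a := 2 * m / (M + m) with ha
  set B := (vmax + Vbar + 1) ^ 5 * (momentL vmin vmax pL 0 + momentR vmin vmax pR 0) with hB
  set κ := 32 / Vbar ^ 4 * (vmax + Vbar) with hκ
  set D := relDiff vmin vmax pL pR with hD
  have ha0 : 0 < a := hp.ratio_pos
  have ha1 : a ≤ 1 := hp.ratio_le_one
  have hV := hp.Vbar_pos
  have hvm := hp.vmin_pos
  obtain ⟨hm1, hm2, hm3, hm4⟩ := vmin_mul_moment_le hp.vmin_lt.le hL hR
  have hL0 : 0 < vmax + Vbar := by linarith [hp.vmin_lt]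
  have hB0 : 0 ≤ B := mul_nonneg (by positivity) (by linarith)
  have hκ0 : 0 ≤ κ := by positivity
  -- The summand 1 in the base of `B` makes its fifth power dominate (vmax + Vbar)^j for every j ≤
  -- 5.
  have hDB : ∀ j ≤ 5, ∀ u, |u| ≤ Vbar → |D j u| ≤ B := by
    intro j hj u hu
    refine (abs_relDiff_le hp hL hR hu j).trans (mul_le_mul_of_nonneg_right ?_ (by linarith))
    exact (pow_le_pow_left₀ hL0.le (by linarith) j).trans (pow_le_pow_right₀ (by linarith) hj)
  have hD2 : ∀ u, D 2 u = -2 * u * Q 1 + u ^ 2 * Q 0 := by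
    intro u
    rw [hD, relDiff_two hL.integrable hR.integrable, ← hQ, ← hQ, ← hQ, hQ2]; ring
  have hD3 : ∀ u, D 3 u = Q 3 + 3 * u ^ 2 * Q 1 - u ^ 3 * Q 0 := by
    intro u
    rw [hD, relDiff_three hL.integrable hR.integrable, ← hQ, ← hQ, ← hQ, ← hQ, hQ2]; ring
  -- From vmin·|Q₀| ≤ Q₁ and Vbar < vmin/3. The term Q₀u² then takes away at most a sixth of the
  -- restoring drift -2Q₁u: for u² the coefficient 4 becomes 4 - 2/3 = 10/3, and for u⁴ the
  -- coefficient 8 becomes 8 - 4/3 = 20/3.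
  have hQ10 : ∀ u, |u| ≤ Vbar → u * Q 0 ≤ Q 1 / 3 := by
    intro u hu
    have h1 : vmin * |Q 0| ≤ Q 1 := by
      rw [hQ, hQ]
      rcases abs_cases (momentL vmin vmax pL 0 - momentR vmin vmax pR 0) with h | h <;>
        rw [h.1] <;> nlinarith [mul_nonneg hvm.le hm3, mul_nonneg hvm.le hm4]
    have h2 : u * Q 0 ≤ |u| * |Q 0| := (le_abs_self _).trans_eq (abs_mul _ _)
    have h3 := mul_le_mul_of_nonneg_right (hu.trans (show Vbar ≤ vmin / 3 by
      linarith [hp.three_mul_Vbar_lt])) (abs_nonneg (Q 0))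
    linarith
  have hc : ∀ u, |u| ≤ Vbar → ∀ v, |v| ≤ vmax → ∃ r w,
      reflectVel Vbar (pistonAfter m M u v) = r ∧ w = u + a * (v - u) ∧
      |r| ≤ |w| ∧ |w| ≤ 3 / 2 * Vbar ∧ |r - w| ≤ κ * a * u ^ 4 := fun u hu v hv =>
    hp.collision_bounds hu hv
  have he0 : ∀ u : ℝ, 0 ≤ κ * a * u ^ 4 := fun u => by positivity
  have hnn := @IsStationary.moments_nonneg vmin vmax Vbar m M pL pR Ω _ P _ Γ W c μ hμ hp hL hR
    hP hW
  rw [← hD] at hnn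
  -- Testing with both φ and -φ, through the sign `s`, turns the one-sided inequality into a bound
  -- on an absolute value.
  have two_sided : ∀ {x y : ℝ}, (∀ s : ℝ, s = 1 ∨ s = -1 → 0 ≤ a * (s * x + y)) → |x| ≤ y := by
    intro x y h
    have h1 := nonneg_of_mul_nonneg_right (h 1 (Or.inl rfl)) ha0
    have h2 := nonneg_of_mul_nonneg_right (h (-1) (Or.inr rfl)) ha0
    exact abs_le.2 ⟨by linarith, by linarith⟩
  have habs : ∀ {s x y : ℝ}, (s = 1 ∨ s = -1) → |x| ≤ y → s * x ≤ y := by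
    rintro s x y (rfl | rfl) h
    · linarith [le_abs_self x]
    · linarith [neg_abs_le x]
  refine ⟨integral_nonneg fun u => sq_nonneg u, integral_nonneg fun u => by positivity,
    ?_, ?_, ?_, two_sided fun s hs => ?_, two_sided fun s hs => ?_, two_sided fun s hs => ?_⟩
  · rw [← integral_const_mul]
    refine norm_integral_le_of_norm_le (f := fun u : ℝ => u ^ 3)
      (hμ.integrable (by fun_prop)) ?_
    filter_upwards [hμ.ae_mem] with u hu
    rw [Real.norm_eq_abs, abs_pow, pow_succ', sq_abs]
    exact mul_le_mul_of_nonneg_right (abs_le.2 hu) (sq_nonneg u)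
  · have h := hnn (φ := fun u => u ^ 2) (by fun_prop) (c₀ := fun _ => 0)
      (c₁ := fun u => 2 * u * a) (c₂ := fun _ => a ^ 2) (c₃ := fun _ => 0) (c₄ := fun _ => 0)
      (α₀ := a ^ 2 * B) (α₁ := 0) (α₂ := -(10 / 3) * a * Q 1) (α₃ := 0) (α₄ := 0) ?_ ?_
    · have h1 : 0 ≤ a * (a * B - 10 / 3 * Q 1 * ∫ u, u ^ 2 ∂μ) := by linarith
      linarith [nonneg_of_mul_nonneg_right h1 ha0]
    · intro u hu v hv
      obtain ⟨r, w, hr, hw, h1, -, -⟩ := hc u hu v hv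
      rw [jump, hr]
      have := sq_le_sq.2 h1
      subst hw
      linarith
    · intro u hu
      have h1 := mul_le_mul_of_nonneg_left ((le_abs_self _).trans (hDB 3 (by norm_num) u hu))
        (sq_nonneg a)
      have h2 := mul_le_mul_of_nonneg_left (hQ10 u hu)
        (show 0 ≤ 2 * a * u ^ 2 by positivity)
      rw [hD2 u]
      linarith
  · have h := hnn (φ := fun u => u ^ 4) (by fun_prop) (c₀ := fun _ => 0)
      (c₁ := fun u => 4 * u ^ 3 * a) (c₂ := fun u => 6 * u ^ 2 * a ^ 2)
      (c₃ := fun u => 4 * u * a ^ 3) (c₄ := fun _ => a ^ 4)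
      (α₀ := a ^ 3 * (B * (4 * Vbar + 1))) (α₁ := 0) (α₂ := 6 * a ^ 2 * B) (α₃ := 0)
      (α₄ := -(20 / 3) * a * Q 1) ?_ ?_
    · have h1 : 0 ≤ a * (6 * a * B * (∫ u, u ^ 2 ∂μ) + a ^ 2 * (B * (4 * Vbar + 1)) -
          20 / 3 * Q 1 * ∫ u, u ^ 4 ∂μ) := by linarith
      linarith [nonneg_of_mul_nonneg_right h1 ha0]
    · intro u hu v hv
      obtain ⟨r, w, hr, hw, h1, -, -⟩ := hc u hu v hv
      rw [jump, hr]
      have h2 := pow_le_pow_left₀ (abs_nonneg r) h1 4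
      rw [Even.pow_abs (by decide : Even 4), Even.pow_abs (by decide : Even 4)] at h2
      subst hw
      linarith
    · intro u hu
      have h1 := mul_le_mul_of_nonneg_left ((le_abs_self _).trans (hDB 3 (by norm_num) u hu))
        (show 0 ≤ 6 * u ^ 2 * a ^ 2 by positivity)
      have h2 := mul_le_mul_of_nonneg_left (hQ10 u hu)
        (show 0 ≤ 4 * a * u ^ 4 by positivity)
      have h3 : 4 * u * a ^ 3 * D 4 u ≤ 4 * Vbar * a ^ 3 * B := by
        refine (le_abs_self _).trans ?_
        rw [abs_mul, abs_mul, abs_mul, abs_of_pos (show (0 : ℝ) < 4 by norm_num),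
          abs_of_pos (pow_pos ha0 3)]
        have := hDB 4 (by norm_num) u hu
        gcongr
      have h4 : a ^ 4 * D 5 u ≤ a ^ 3 * B := by
        have h5 := mul_le_mul_of_nonneg_left ((le_abs_self _).trans (hDB 5 (by norm_num) u hu))
          (show 0 ≤ a ^ 4 by positivity)
        refine h5.trans (mul_le_mul_of_nonneg_right ?_ hB0)
        exact pow_le_pow_of_le_one ha0.le ha1 (by norm_num)
      rw [hD2 u]
      linarith
  · have h := hnn (φ := fun u => s * u) (by fun_prop) (c₀ := fun u => κ * a * u ^ 4)
      (c₁ := fun _ => s * a) (c₂ := fun _ => 0) (c₃ := fun _ => 0) (c₄ := fun _ => 0)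
      (α₀ := 0) (α₁ := s * a * (-2 * Q 1)) (α₂ := s * a * Q 0) (α₃ := 0) (α₄ := κ * a * B) ?_ ?_
    · linarith
    · intro u hu v hv
      obtain ⟨r, w, hr, hw, -, -, h1⟩ := hc u hu v hv
      rw [jump, hr]
      have := habs hs h1
      subst hw
      linarith
    · intro u hu
      have h1 := mul_le_mul_of_nonneg_left ((le_abs_self _).trans (hDB 1 (by norm_num) u hu))
        (he0 u)
      rw [hD2 u]
      linarith
  · have h := hnn (φ := fun u => s * u ^ 2) (by fun_prop)
      (c₀ := fun u => 3 * Vbar * (κ * a * u ^ 4))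
      (c₁ := fun u => s * (2 * u * a)) (c₂ := fun _ => s * a ^ 2) (c₃ := fun _ => 0)
      (c₄ := fun _ => 0) (α₀ := s * a ^ 2 * Q 3) (α₁ := 0)
      (α₂ := s * (-4 * a * Q 1 + 3 * a ^ 2 * Q 1)) (α₃ := s * (2 * a * Q 0 - a ^ 2 * Q 0))
      (α₄ := 3 * Vbar * κ * a * B) ?_ ?_
    · linarith
    · intro u hu v hv
      obtain ⟨r, w, hr, hw, h0, h2, h1⟩ := hc u hu v hv
      rw [jump, hr]
      -- r² - w² = (r + w)(r - w), with |r| and |w| at most 3Vbar/2.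
      have h3 : |r ^ 2 - w ^ 2| ≤ 3 * Vbar * (κ * a * u ^ 4) := by
        rw [sq_sub_sq, abs_mul]
        refine mul_le_mul ((abs_add_le _ _).trans (by linarith)) h1 (abs_nonneg _) (by linarith)
      have := habs hs h3
      subst hw
      linarith
    · intro u hu
      have h1 := mul_le_mul_of_nonneg_left ((le_abs_self _).trans (hDB 1 (by norm_num) u hu))
        (mul_nonneg (show 0 ≤ 3 * Vbar by linarith) (he0 u))
      rw [hD2 u, hD3 u]
      linarith
  · have h := hnn (φ := fun u => s * u ^ 3) (by fun_prop)
      (c₀ := fun u => 7 * Vbar ^ 2 * (κ * a * u ^ 4))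
      (c₁ := fun u => s * (3 * u ^ 2 * a)) (c₂ := fun u => s * (3 * u * a ^ 2))
      (c₃ := fun _ => s * a ^ 3) (c₄ := fun _ => 0) (α₀ := a ^ 3 * B)
      (α₁ := s * (3 * a ^ 2 * Q 3)) (α₂ := 0) (α₃ := s * (-6 * a * Q 1 + 9 * a ^ 2 * Q 1))
      (α₄ := s * (3 * a * Q 0 - 3 * a ^ 2 * Q 0) + 7 * Vbar ^ 2 * κ * a * B) ?_ ?_
    · linarith
    · intro u hu v hv
      obtain ⟨r, w, hr, hw, h0, h2, h1⟩ := hc u hu v hv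
      rw [jump, hr]
      -- The factor r² + rw + w² is at most 3·(3Vbar/2)² = 27Vbar²/4, rounded up to 7Vbar².
      have h3 : |r ^ 3 - w ^ 3| ≤ 7 * Vbar ^ 2 * (κ * a * u ^ 4) := by
        have e : r ^ 3 - w ^ 3 = (r ^ 2 + r * w + w ^ 2) * (r - w) := by ring
        rw [e, abs_mul]
        refine mul_le_mul ?_ h1 (abs_nonneg _) (by positivity)
        have h4 : r ^ 2 ≤ (3 / 2 * Vbar) ^ 2 := sq_le_sq' (by linarith [neg_abs_le r])
          (by linarith [le_abs_self r])
        have h5 : w ^ 2 ≤ (3 / 2 * Vbar) ^ 2 := sq_le_sq' (by linarith [neg_abs_le w])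
          (by linarith [le_abs_self w])
        refine abs_le.2 ⟨?_, ?_⟩
        · linarith [sq_nonneg (r + w), sq_nonneg r, sq_nonneg w, sq_nonneg Vbar]
        · linarith [sq_nonneg (r - w), sq_nonneg Vbar]
      have := habs hs h3
      subst hw
      linarith
    · intro u hu
      have h1 := mul_le_mul_of_nonneg_left ((le_abs_self _).trans (hDB 1 (by norm_num) u hu))
        (mul_nonneg (show 0 ≤ 7 * Vbar ^ 2 by positivity) (he0 u))
      have h2 := mul_le_mul_of_nonneg_left (habs hs (hDB 4 (by norm_num) u hu))
        (show 0 ≤ a ^ 3 by positivity)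
      rw [hD2 u, hD3 u]
      linarith

end VelocityProcess

/-! ### The order of the moments -/

section Asymptotics

open Asymptotics

variable {ι : Type*} {S : Set ι} {a b₁ b₂ b₃ b₄ : ι → ℝ} {V B κ Q₀ Q₁ Q₃ : ℝ}

/-- The orders in `a` of the moments of the stationary measures. -/
theorem moments_isBigO (hQ₁ : 0 < Q₁) (ha : ∀ i ∈ S, 0 < a i ∧ a i ≤ 1)
    (h : ∀ i ∈ S, MomentRelations (a i) V B κ Q₀ Q₁ Q₃ (b₁ i) (b₂ i) (b₃ i) (b₄ i)) :
    b₁ =O[𝓟 S] a ∧ b₂ =O[𝓟 S] a ∧ b₃ =O[𝓟 S] (fun i => a i ^ 2) ∧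
      (fun i => b₂ i - a i * Q₃ / (4 * Q₁)) =O[𝓟 S] fun i => a i ^ 2 := by
  have hb₂ : b₂ =O[𝓟 S] a := by
    refine IsBigO.of_bound (3 / (10 * Q₁) * B) (eventually_principal.2 fun i hi => ?_)
    rw [Real.norm_of_nonneg (h i hi).b₂_nonneg, Real.norm_of_nonneg (ha i hi).1.le]
    have h1 := (h i hi).second_le
    have e : 3 / (10 * Q₁) * B * a i = a i * B / (10 / 3 * Q₁) := by field_simp
    rw [e, le_div_iff₀ (by positivity)]
    linarith
  have ha2 : (fun i => a i ^ 2) =O[𝓟 S] a := by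
    refine IsBigO.of_bound 1 (eventually_principal.2 fun i hi => ?_)
    rw [Real.norm_of_nonneg (sq_nonneg _), Real.norm_of_nonneg (ha i hi).1.le]
    nlinarith [ha i hi]
  have haa : (fun i => a i * a i) =O[𝓟 S] fun i => a i ^ 2 := by
    simpa only [sq] using isBigO_refl (fun i => a i * a i) (𝓟 S)
  have hab : ∀ {f : ι → ℝ}, f =O[𝓟 S] a → (fun i => a i * f i) =O[𝓟 S] fun i => a i ^ 2 :=
    fun hf => ((isBigO_refl a _).mul hf).trans haa
  have hb₄ : b₄ =O[𝓟 S] fun i => a i ^ 2 := by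
    have h1 : (fun i => 6 * B * (a i * b₂ i) + B * (4 * V + 1) * a i ^ 2) =O[𝓟 S]
        fun i => a i ^ 2 := ((hab hb₂).const_mul_left _).add ((isBigO_refl _ _).const_mul_left _)
    refine IsBigO.trans (IsBigO.of_bound (3 / (20 * Q₁)) (eventually_principal.2 fun i hi => ?_))
      h1
    rw [Real.norm_of_nonneg (h i hi).b₄_nonneg]
    have h2 := (h i hi).fourth_le
    refine le_trans ?_ (mul_le_mul_of_nonneg_left (le_abs_self _) (by positivity))
    rw [div_mul_eq_mul_div, le_div_iff₀ (by positivity)]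
    linarith
  -- A crude bound: it suffices wherever b₃ carries a factor a, and so starts the bootstrap to b₃ =
  -- O(a²).
  have hb₃' : b₃ =O[𝓟 S] a := by
    refine IsBigO.trans (IsBigO.of_bound V (eventually_principal.2 fun i hi => ?_)) hb₂
    rw [Real.norm_of_nonneg (h i hi).b₂_nonneg]
    exact (h i hi).abs_b₃_le
  have hb₁ : b₁ =O[𝓟 S] a := by
    have h1 : (fun i => -2 * Q₁ * b₁ i + Q₀ * b₂ i) =O[𝓟 S] b₄ :=
      IsBigO.of_bound (κ * B) (eventually_principal.2 fun i hi => by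
        rw [Real.norm_of_nonneg (h i hi).b₄_nonneg]
        exact (h i hi).first)
    refine ((((h1.trans hb₄).trans ha2).const_mul_left (-(2 * Q₁)⁻¹)).add
      (hb₂.const_mul_left (Q₀ / (2 * Q₁)))).congr_left fun i => ?_
    field_simp
    ring
  have hb₃ : b₃ =O[𝓟 S] fun i => a i ^ 2 := by
    have h1 : (fun i => B * a i ^ 2 + 7 * V ^ 2 * κ * B * b₄ i) =O[𝓟 S] fun i => a i ^ 2 :=
      ((isBigO_refl _ _).const_mul_left _).add (hb₄.const_mul_left _)
    have h2 : (fun i => -6 * Q₁ * b₃ i + 3 * Q₀ * b₄ i + a i * (3 * Q₃ * b₁ i + 9 * Q₁ * b₃ i -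
        3 * Q₀ * b₄ i)) =O[𝓟 S] fun i => a i ^ 2 := by
      refine IsBigO.trans (IsBigO.of_bound 1 (eventually_principal.2 fun i hi => ?_)) h1
      rw [one_mul, Real.norm_eq_abs, Real.norm_eq_abs]
      exact (h i hi).third.trans ((le_abs_self _).trans_eq (by rw [mul_comm B]))
    have h3 : (fun i => a i * (3 * Q₃ * b₁ i + 9 * Q₁ * b₃ i - 3 * Q₀ * b₄ i)) =O[𝓟 S]
        fun i => a i ^ 2 :=
      hab (((hb₁.const_mul_left _).add (hb₃'.const_mul_left _)).sub
        ((hb₄.trans ha2).const_mul_left _))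
    refine ((((h2.sub h3).sub (hb₄.const_mul_left (3 * Q₀)))).const_mul_left
      (-(6 * Q₁)⁻¹)).congr_left fun i => ?_
    field_simp
    ring
  refine ⟨hb₁, hb₂, hb₃, ?_⟩
  -- Up to O(a²) the second relation reads -4Q₁b₂ + aQ₃ = 0, which identifies the leading term of
  -- b₂.
  have h1 : (fun i => -4 * Q₁ * b₂ i + 2 * Q₀ * b₃ i + a i * (Q₃ + 3 * Q₁ * b₂ i -
      Q₀ * b₃ i)) =O[𝓟 S] b₄ :=
    IsBigO.of_bound (3 * V * κ * B) (eventually_principal.2 fun i hi => by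
      rw [Real.norm_of_nonneg (h i hi).b₄_nonneg]
      exact (h i hi).second)
  have h2 : (fun i => a i * (3 * Q₁ * b₂ i - Q₀ * b₃ i)) =O[𝓟 S] fun i => a i ^ 2 :=
    hab ((hb₂.const_mul_left _).sub (hb₃'.const_mul_left _))
  refine ((((h1.trans hb₄).sub h2).sub (hb₃.const_mul_left (2 * Q₀))).const_mul_left
    (-(4 * Q₁)⁻¹)).congr_left fun i => ?_
  field_simp
  ring

/-- The expansion of the heat flow in terms of `a`. -/
theorem heat_isBigO (hQ₁ : 0 < Q₁) (ha : ∀ i ∈ S, 0 < a i ∧ a i ≤ 1)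
    (h : ∀ i ∈ S, MomentRelations (a i) V B κ Q₀ Q₁ Q₃ (b₁ i) (b₂ i) (b₃ i) (b₄ i))
    (F₀ F₁ F₂ F₃ : ℝ) :
    (fun i => (2 - a i) * (2 * b₂ i * F₁ - b₃ i * F₀ - a i / 2 * F₃ +
      a i / 2 * (3 * b₁ i * F₂ - 3 * b₂ i * F₁ + b₃ i * F₀) - 2 * b₁ i ^ 2 * F₁ +
      b₁ i * b₂ i * F₀) - a i * ((Q₃ * F₁ - F₃ * Q₁) / Q₁)) =O[𝓟 S] fun i => a i ^ 2 := by
  obtain ⟨hb₁, hb₂, hb₃, hb⟩ := moments_isBigO hQ₁ ha h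
  have haa : (fun i => a i * a i) =O[𝓟 S] fun i => a i ^ 2 := by
    simpa only [sq] using isBigO_refl (fun i => a i * a i) (𝓟 S)
  have hone : a =O[𝓟 S] fun _ => (1 : ℝ) :=
    IsBigO.of_bound 1 (eventually_principal.2 fun i hi => by
      rw [Real.norm_of_nonneg (ha i hi).1.le]; simpa using (ha i hi).2)
  have h2a : (fun i => 2 - a i) =O[𝓟 S] fun _ => (1 : ℝ) :=
    (isBigO_const_const (2 : ℝ) one_ne_zero _).sub hone
  have e1 : (fun i => a i * (3 * b₁ i * F₂ - 3 * b₂ i * F₁)) =O[𝓟 S] fun i => a i ^ 2 := by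
    refine (((isBigO_refl a _).mul ((hb₁.const_mul_left (3 * F₂)).sub
      (hb₂.const_mul_left (3 * F₁)))).trans haa).congr_left fun i => ?_
    ring
  have e2 : (fun i => a i * b₃ i) =O[𝓟 S] fun i => a i ^ 2 := by
    simpa using hone.mul hb₃
  have e3 : (fun i => b₁ i * b₁ i) =O[𝓟 S] fun i => a i ^ 2 := (hb₁.mul hb₁).trans haa
  have e4 : (fun i => b₁ i * b₂ i) =O[𝓟 S] fun i => a i ^ 2 := (hb₁.mul hb₂).trans haa
  have e5 := (((((hb.const_mul_left (2 * F₁)).sub (hb₃.const_mul_left F₀)).add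
    (e1.const_mul_left (1 / 2))).add (e2.const_mul_left (F₀ / 2))).sub
    (e3.const_mul_left (2 * F₁))).add (e4.const_mul_left F₀)
  have e6 := (h2a.mul e5).congr_right (g₂ := fun i => a i ^ 2) fun i => one_mul _
  -- Put X = (Q₃F₁ - F₃Q₁)/Q₁. The terms outside `e5` are 2F₁·aQ₃/(4Q₁) - aF₃/2 = aX/2, and (2 -
  -- a)·aX/2 = aX - a²X/2; the last term is the one subtracted here.
  refine (e6.sub ((isBigO_refl (fun i => a i ^ 2) _).const_mul_left
    ((Q₃ * F₁ - F₃ * Q₁) / (2 * Q₁)))).congr_left fun i => ?_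
  field_simp
  ring

end Asymptotics

/-- The expansion of the heat flow with a constant that does not depend on the masses. -/
theorem exists_heat_bound {V B κ Q₀ Q₁ Q₃ : ℝ} (hQ₁ : 0 < Q₁) (F₀ F₁ F₂ F₃ : ℝ) :
    ∃ C, ∀ a b₁ b₂ b₃ b₄ : ℝ, 0 < a → a ≤ 1 → MomentRelations a V B κ Q₀ Q₁ Q₃ b₁ b₂ b₃ b₄ →
      |(2 - a) * (2 * b₂ * F₁ - b₃ * F₀ - a / 2 * F₃ +
        a / 2 * (3 * b₁ * F₂ - 3 * b₂ * F₁ + b₃ * F₀) - 2 * b₁ ^ 2 * F₁ +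
        b₁ * b₂ * F₀) - a * ((Q₃ * F₁ - F₃ * Q₁) / Q₁)| ≤ C * a ^ 2 := by
  -- The index set consists of all tuples that satisfy the relations, so O with respect to its
  -- principal filter is a bound with one constant for all masses and measures.
  have h := heat_isBigO (ι := ℝ × ℝ × ℝ × ℝ × ℝ) (S := {x | (0 < x.1 ∧ x.1 ≤ 1) ∧
    MomentRelations x.1 V B κ Q₀ Q₁ Q₃ x.2.1 x.2.2.1 x.2.2.2.1 x.2.2.2.2})
    (a := fun x => x.1) (b₁ := fun x => x.2.1) (b₂ := fun x => x.2.2.1)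
    (b₃ := fun x => x.2.2.2.1) (b₄ := fun x => x.2.2.2.2) hQ₁ (fun x hx => hx.1)
    (fun x hx => hx.2) F₀ F₁ F₂ F₃
  obtain ⟨C, hC⟩ := Asymptotics.isBigO_principal.1 h
  refine ⟨C, fun a b₁ b₂ b₃ b₄ h0 h1 hr => ?_⟩
  simpa using hC (a, b₁, b₂, b₃, b₄) ⟨⟨h0, h1⟩, hr⟩

/-! ### The heat flow -/

section VelocityProcess

variable {vmin vmax Vbar m M : ℝ} {pL pR : ℝ → ℝ}
  {Ω : Type*} [MeasurableSpace Ω] {P : Measure Ω} [IsProbabilityMeasure P]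
  {Γ : Ω → Set (ℝ × ℝ)} {W : ℝ → Ω → ℝ → ℝ} {c : ℝ → Ω → ℝ × ℝ → ℝ → ℝ} {μ : Measure ℝ}

theorem Admissible.atomAfter_eq (hp : Admissible m M Vbar vmin vmax) (u v : ℝ) :
    atomAfter m M u v = v - (2 - 2 * m / (M + m)) * (v - u) := by
  have hs : M + m ≠ 0 := by linarith [hp.m_pos, hp.M_pos]
  unfold atomAfter; field_simp; ring

theorem rate_left (hL : Integrable pL) {g : ℝ → ℝ} {u c₁ c₂ : ℝ}
    (hg : ∀ v, g v = c₁ * (v - u) + c₂ * (v - u) ^ 2) :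
    rate vmin vmax pL pR u g (fun _ => 0) =
      c₁ * relMoment vmin vmax pL 2 u + c₂ * relMoment vmin vmax pL 3 u := by
  have h := integral_mul_quartic (a := vmin) (b := vmax) hL u 0 c₁ c₂ 0 0
  have e : (fun v => (v - u) * g v * pL v) = fun v => (v - u) * (0 + c₁ * (v - u) +
      c₂ * (v - u) ^ 2 + 0 * (v - u) ^ 3 + 0 * (v - u) ^ 4) * pL v := by
    funext v; rw [hg]; ring
  rw [rate, e, h]
  simp

/-- With a = 2m/(M+m), the atomic velocity v' after collision satisfies v' - v = -(2 - a)(v - u) and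
v' + v = 2u + a(v - u). The energy change is their product times m/2, and the flux weight v - u
raises each power by one. -/
theorem meanEnergyGain_hasDerivWithinAt (hp : Admissible m M Vbar vmin vmax)
    (hL : IsGasDensity vmin vmax pL) (hR : IsGasDensity vmin vmax pR)
    (hP : IsPoissonProcess Γ (gasIntensity pL pR) P) (hW : IsPistonProcess P m M Vbar Γ W c)
    {u : ℝ} (hu : u ∈ Icc (-Vbar) Vbar) :
    (∀ t, 0 ≤ t → Integrable (fun ω => leftEnergyGain m (Γ ω) (c u ω) t) P) ∧
    HasDerivWithinAt (meanEnergyGain P m Γ c u)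
      (-(m / 2 * (2 - 2 * m / (M + m))) * (2 * u * relMoment vmin vmax pL 2 u +
        2 * m / (M + m) * relMoment vmin vmax pL 3 u)) (Ici 0) 0 := by
  obtain ⟨C, hC⟩ := left_gain_estimate hp hL hR hP hW (ψ := fun x => m / 2 * x ^ 2)
    (by fun_prop) fun u hu t ht => hW.measurable_energy u hu t ht
  refine ⟨fun t ht => (hC u hu t ht).1, hasDerivWithinAt_of_quadratic (C := C) fun t ht => ?_⟩
  have h := (hC u hu t ht).2
  rw [rate_left hL.integrable (c₁ := -(m / 2 * (2 - 2 * m / (M + m))) * (2 * u))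
    (c₂ := -(m / 2 * (2 - 2 * m / (M + m))) * (2 * m / (M + m))) fun v => by
      rw [hp.atomAfter_eq]; ring] at h
  convert! h using 4
  ring

theorem meanMomentumGain_hasDerivWithinAt (hp : Admissible m M Vbar vmin vmax)
    (hL : IsGasDensity vmin vmax pL) (hR : IsGasDensity vmin vmax pR)
    (hP : IsPoissonProcess Γ (gasIntensity pL pR) P) (hW : IsPistonProcess P m M Vbar Γ W c)
    {u : ℝ} (hu : u ∈ Icc (-Vbar) Vbar) :
    (∀ t, 0 ≤ t → Integrable (fun ω => leftMomentumGain m (Γ ω) (c u ω) t) P) ∧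
    HasDerivWithinAt (meanMomentumGain P m Γ c u)
      (-(m * (2 - 2 * m / (M + m))) * relMoment vmin vmax pL 2 u) (Ici 0) 0 := by
  obtain ⟨C, hC⟩ := left_gain_estimate hp hL hR hP hW (ψ := fun x => m * x)
    (by fun_prop) fun u hu t ht => hW.measurable_momentum u hu t ht
  refine ⟨fun t ht => (hC u hu t ht).1, hasDerivWithinAt_of_quadratic (C := C) fun t ht => ?_⟩
  have h := (hC u hu t ht).2
  rw [rate_left hL.integrable (c₁ := -(m * (2 - 2 * m / (M + m)))) (c₂ := 0) fun v => by
      rw [hp.atomAfter_eq]; ring] at h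
  rw [zero_mul, add_zero] at h
  exact h

theorem energyRate_eq (hp : Admissible m M Vbar vmin vmax)
    (hL : IsGasDensity vmin vmax pL) (hR : IsGasDensity vmin vmax pR)
    (hP : IsPoissonProcess Γ (gasIntensity pL pR) P) (hW : IsPistonProcess P m M Vbar Γ W c)
    {F : ℕ → ℝ} (hF : ∀ k, F k = momentL vmin vmax pL k) {a : ℝ} (ha : a = 2 * m / (M + m))
    {u : ℝ} (hu : u ∈ Icc (-Vbar) Vbar) :
    energyRate P m Γ c u = -(m / 2 * (2 - a)) * (a * F 3) +
      -(m / 2 * (2 - a)) * (2 * F 2 - 3 * a * F 2) * u +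
      -(m / 2 * (2 - a)) * (3 * a * F 1 - 4 * F 1) * u ^ 2 +
      -(m / 2 * (2 - a)) * (2 * F 0 - a * F 0) * u ^ 3 + 0 * u ^ 4 := by
  rw [energyRate, (meanEnergyGain_hasDerivWithinAt hp hL hR hP hW hu).2.derivWithin
    (uniqueDiffWithinAt_Ici 0), relMoment_two hL.integrable, relMoment_three hL.integrable, ← ha,
    hF, hF, hF, hF]
  unfold momentL
  ring

theorem momentumRate_eq (hp : Admissible m M Vbar vmin vmax)
    (hL : IsGasDensity vmin vmax pL) (hR : IsGasDensity vmin vmax pR)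
    (hP : IsPoissonProcess Γ (gasIntensity pL pR) P) (hW : IsPistonProcess P m M Vbar Γ W c)
    {F : ℕ → ℝ} (hF : ∀ k, F k = momentL vmin vmax pL k) {a : ℝ} (ha : a = 2 * m / (M + m))
    {u : ℝ} (hu : u ∈ Icc (-Vbar) Vbar) :
    momentumRate P m Γ c u = -(m * (2 - a)) * F 2 + m * (2 - a) * (2 * F 1) * u +
      -(m * (2 - a)) * F 0 * u ^ 2 + 0 * u ^ 3 + 0 * u ^ 4 := by
  rw [momentumRate, (meanMomentumGain_hasDerivWithinAt hp hL hR hP hW hu).2.derivWithin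
    (uniqueDiffWithinAt_Ici 0), relMoment_two hL.integrable, ← ha, hF, hF, hF]
  unfold momentL
  ring

theorem heatFlowExists (hp : Admissible m M Vbar vmin vmax)
    (hL : IsGasDensity vmin vmax pL) (hR : IsGasDensity vmin vmax pR)
    (hP : IsPoissonProcess Γ (gasIntensity pL pR) P) (hW : IsPistonProcess P m M Vbar Γ W c)
    (hμ : IsStationary P Vbar W μ) : HeatFlowExists P m Vbar Γ c μ where
  integrable_energy u hu := (meanEnergyGain_hasDerivWithinAt hp hL hR hP hW hu).1
  integrable_momentum u hu := (meanMomentumGain_hasDerivWithinAt hp hL hR hP hW hu).1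
  differentiable_energy u hu :=
    (meanEnergyGain_hasDerivWithinAt hp hL hR hP hW hu).2.differentiableWithinAt
  differentiable_momentum u hu :=
    (meanMomentumGain_hasDerivWithinAt hp hL hR hP hW hu).2.differentiableWithinAt
  integrable_energyRate := by
    refine Integrable.congr (hμ.integrable ?_) (hμ.ae_mem.mono fun u hu =>
      (energyRate_eq hp hL hR hP hW (fun _ => rfl) rfl hu).symm)
    fun_prop
  integrable_momentumRate := by
    refine Integrable.congr (hμ.integrable ?_) (hμ.ae_mem.mono fun u hu =>
      (momentumRate_eq hp hL hR hP hW (fun _ => rfl) rfl hu).symm)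
    fun_prop
  integrable_velocity := hμ.integrable continuous_id

/-- The constant part of the momentum rate, multiplied by b₁, cancels the term -m(2 - a)F₂b₁ of the
energy rate. The remaining F₂ term has the extra factor a/2, so knowing b₁ = O(a) is enough. -/
theorem heatFlow_eq (hp : Admissible m M Vbar vmin vmax)
    (hL : IsGasDensity vmin vmax pL) (hR : IsGasDensity vmin vmax pR)
    (hP : IsPoissonProcess Γ (gasIntensity pL pR) P) (hW : IsPistonProcess P m M Vbar Γ W c)
    (hμ : IsStationary P Vbar W μ) {F : ℕ → ℝ} (hF : ∀ k, F k = momentL vmin vmax pL k)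
    {a b₁ b₂ b₃ : ℝ} (ha : a = 2 * m / (M + m)) (h₁ : b₁ = ∫ u, u ∂μ)
    (h₂ : b₂ = ∫ u, u ^ 2 ∂μ) (h₃ : b₃ = ∫ u, u ^ 3 ∂μ) :
    heatFlow P m Γ c μ = m * ((2 - a) * (2 * b₂ * F 1 - b₃ * F 0 - a / 2 * F 3 +
        a / 2 * (3 * b₁ * F 2 - 3 * b₂ * F 1 + b₃ * F 0) - 2 * b₁ ^ 2 * F 1 +
        b₁ * b₂ * F 0)) := by
  rw [heatFlow, integral_congr_ae (hμ.ae_mem.mono fun u hu =>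
      energyRate_eq hp hL hR hP hW hF ha hu),
    integral_congr_ae (hμ.ae_mem.mono fun u hu => momentumRate_eq hp hL hR hP hW hF ha hu),
    hμ.integral_quartic, hμ.integral_quartic, ← h₁, ← h₂, ← h₃]
  ring

end VelocityProcess

end Piston

/-! ### Choice of the constants and passage to ε -/

theorem mainTheorem4
    (vmin vmax : ℝ) (hvmin : 0 < vmin) (hvmax : vmin < vmax)
    (nL nR : ℝ) (hnL : 0 < nL) (hnR : 0 < nR)
    (fL fR pL pR : ℝ → ℝ)
    (hfL : Piston.IsVelocityDensity vmin vmax fL)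
    (hfR : Piston.IsVelocityDensity vmin vmax fR)
    (hpL : ∀ v, pL v = nL * fL v) (hpR : ∀ v, pR v = nR * fR v)
    (FL FR Q : ℕ → ℝ)
    (hFL : ∀ k, FL k = Piston.momentL vmin vmax pL k)
    (hFR : ∀ k, FR k = Piston.momentR vmin vmax pR k)
    (hQ : ∀ k, Q k = FL k - FR k)
    (hbalance : Q 2 = 0)
    (Vbar : ℝ) (hVbar : 0 < Vbar) :
    ∃ C ε₀ : ℝ, 0 < ε₀ ∧
      ∀ m M ε : ℝ, 0 < m → 0 < M → ε = m / M → ε < ε₀ → Vbar < Piston.vMax m M vmin →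
      ∀ {Ω : Type*} [MeasurableSpace Ω] (P : Measure Ω) [IsProbabilityMeasure P]
        (Γ : Ω → Set (ℝ × ℝ)) (W : ℝ → Ω → ℝ → ℝ) (c : ℝ → Ω → ℝ × ℝ → ℝ → ℝ)
        (μ : Measure ℝ),
        Piston.IsPoissonProcess Γ (Piston.gasIntensity pL pR) P →
        Piston.IsPistonProcess P m M Vbar Γ W c →
        Piston.IsStationary P Vbar W μ →
          Piston.HeatFlowExists P m Vbar Γ c μ ∧
          |Piston.heatFlow P m Γ c μ
              - 2 * m * ε / Q 1 * (FR 1 * FL 3 - FL 1 * FR 3)| ≤ C * m * ε ^ 2 := by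
  have hL := hfL.isGasDensity hnL hpL
  have hR := hfR.isGasDensity hnR hpR
  have hvmax0 : 0 < vmax := hvmin.trans hvmax
  have hQ' : ∀ k, Q k = Piston.momentL vmin vmax pL k - Piston.momentR vmin vmax pR k :=
    fun k => by rw [hQ, hFL, hFR]
  have hQ1 : 0 < Q 1 := by
    have h0 := Piston.momentL_zero_pos hvmin hvmax hfL hnL hpL
    obtain ⟨h1, h2, -, h4⟩ := Piston.vmin_mul_moment_le hvmax.le hL hR
    rw [hQ']
    linarith [mul_pos hvmin h0, mul_nonneg hvmin.le h4]
  obtain ⟨C, hC⟩ := Piston.exists_heat_bound (V := Vbar)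
    (B := (vmax + Vbar + 1) ^ 5 *
      (Piston.momentL vmin vmax pL 0 + Piston.momentR vmin vmax pR 0))
    (κ := 32 / Vbar ^ 4 * (vmax + Vbar)) (Q₀ := Q 0) (Q₃ := Q 3) hQ1 (FL 0) (FL 1) (FL 2) (FL 3)
  set X := (Q 3 * FL 1 - FL 3 * Q 1) / Q 1 with hX
  -- Since a ≤ 2ε, this ε₀ ensures a(vmax + Vbar) ≤ Vbar/2, the smallness condition of `Admissible`.
  -- In the constant, 4|C| comes from Ca² ≤ 4|C|ε² and 2|X| from replacing a by 2ε; both are fixed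
  -- before the masses and the process.
  refine ⟨4 * |C| + 2 * |X|, Vbar / (4 * (vmax + Vbar)), by positivity, ?_⟩
  intro m M ε hm hM hε hε₀ hV Ω _ P _ Γ W c μ hP hW hμ
  have hε0 : 0 < ε := hε ▸ div_pos hm hM
  set a := 2 * m / (M + m) with ha
  have haε : a = 2 * ε / (1 + ε) := by rw [ha, hε]; field_simp
  have ha2 : a ≤ 2 * ε := by
    rw [haε, div_le_iff₀ (by linarith)]; nlinarith
  have hp : Piston.Admissible m M Vbar vmin vmax := by
    refine ⟨hm, hM, hVbar, hvmin, hvmax, hV, ?_⟩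
    rw [lt_div_iff₀ (by positivity)] at hε₀
    have := mul_le_mul_of_nonneg_right ha2 (show 0 ≤ vmax + Vbar by linarith)
    linarith
  refine ⟨Piston.heatFlowExists hp hL hR hP hW hμ, ?_⟩
  have ha0 : 0 < a := hp.ratio_pos
  have hrel := hC a _ _ _ _ ha0 hp.ratio_le_one
    (hμ.momentRelations hp hL hR hP hW hQ' hbalance)
  rw [Piston.heatFlow_eq hp hL hR hP hW hμ hFL ha rfl rfl rfl]
  -- In Q₃F₁^- - F₃^-Q₁ the products F₁^-F₃^- cancel, leaving F₁^+F₃^- - F₁^-F₃^+.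
  have hmain : 2 * m * ε / Q 1 * (FR 1 * FL 3 - FL 1 * FR 3) = m * (2 * ε * X) := by
    rw [hX, hQ 1, hQ 3]
    have : FL 1 - FR 1 ≠ 0 := by rw [← hQ 1]; exact hQ1.ne'
    field_simp
    ring
  have hdiff : |a * X - 2 * ε * X| ≤ 2 * |X| * ε ^ 2 := by
    have h1 : 2 * ε - a ≤ 2 * ε ^ 2 := by
      have e : 2 * ε - a = 2 * ε ^ 2 / (1 + ε) := by rw [haε]; field_simp; ring
      rw [e, div_le_iff₀ (by linarith)]
      nlinarith [pow_pos hε0 3]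
    rw [← sub_mul, abs_mul, abs_of_nonpos (by linarith)]
    nlinarith [abs_nonneg X]
  have hCa : C * a ^ 2 ≤ 4 * |C| * ε ^ 2 := by
    have h1 : a ^ 2 ≤ (2 * ε) ^ 2 := pow_le_pow_left₀ ha0.le ha2 2
    have h2 := mul_le_mul (le_abs_self C) h1 (sq_nonneg a) (abs_nonneg C)
    linarith
  rw [hmain, ← mul_sub, abs_mul, abs_of_pos hm]
  have htri := abs_le.1 ((abs_add_le _ _).trans (add_le_add hrel hdiff))
  have := mul_le_mul_of_nonneg_left (abs_le.2 ⟨by linarith [htri.1], by linarith [htri.2]⟩ :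
    |(2 - a) * (2 * (∫ u, u ^ 2 ∂μ) * FL 1 - (∫ u, u ^ 3 ∂μ) * FL 0 - a / 2 * FL 3 +
      a / 2 * (3 * (∫ u, u ∂μ) * FL 2 - 3 * (∫ u, u ^ 2 ∂μ) * FL 1 + (∫ u, u ^ 3 ∂μ) * FL 0) -
      2 * (∫ u, u ∂μ) ^ 2 * FL 1 + (∫ u, u ∂μ) * (∫ u, u ^ 2 ∂μ) * FL 0) - 2 * ε * X| ≤
      (4 * |C| + 2 * |X|) * ε ^ 2) hm.le
  refine this.trans_eq ?_
  ring
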